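/- Let $g:\mathbb R\to\mathbb C$ satisfy a Hölder condition $|g(x)-g(y)|\le C|x-y|^{\alpha}$ on $\mathbb R$ ($0<\alpha\le 1$), have zero index on $\mathbb R$ (number of zeros minus number of poles; since $g$ is finite-valued this means that $g$ has no zero on $\mathbb R$), and satisfy $g(0)=1$. Then $g$ has exactly one continuous logarithm $s=\ln g:\mathbb R\to\mathbb C$ with $e^{s}=g$ and $s(0)=0$. For $\lambda\in\mathbb C$ let $$\phi_s(\lambda)=\frac1{2\pi i}\,\mathrm{p.v.}\!\int_{\mathbb R}\frac{s(x)}{x-\lambda}\,dx$$ be the Sokhotskyi–Plemelj integral, the principal value being taken at infinity (limit of $\int_{|x|\le R}$, $R\to\infty$) and, where needed, at the singularity $x=\lambda$ (limit of the integral over $|x-\lambda|\ge\varepsilon$, $\varepsilon\to0^+$). The difference $\phi_s(\lambda)-\phi_s(0)$ is understood as the limit of the difference of the two truncated integrals as $\varepsilon\to0^+$, $R\to\infty$; it equals the difference of the two integrals whenever these converge separately. Consider pairs $(\Phi^+,\Phi^-)$ with $$\Phi^+(\omega)\Phi^-(\omega)=g(\omega),\qquad \omega\in\mathbb R,$$ where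 $\Phi^{+}$ (resp. $\Phi^{-}$) is analytic in the open upper (resp. lower) half-plane and continuous on its closure, and which are vanishing-normalized: on the respective closed half-plane $\Phi^{\pm}=e^{L^{\pm}}$ with $L^{\pm}$ analytic in the open half-plane, continuous up to the real line, $L^{\pm}(0)=0$ (so $\Phi^\pm(0)=1$), and $L^{\pm}(\lambda)/\lambda\to0$ as $|\lambda|\to\infty$ in the closed half-plane. (a) If $(\Phi^+,\Phi^-)$ is such a solution, then $\phi_s(\lambda)-\phi_s(0)$ exists for every $\lambda\in\mathbb C$, and $$\Phi^{\pm}(\lambda)=\exp\{\pm\phi_{\ln g}(\lambda)\mp\phi_{\ln g}(0)\}$$ for $\lambda$ in the open upper half-plane (upper signs), respectively the open lower half-plane (lower signs). For $\lambda=\omega\in\mathbb R$ the formula holds with $\phi_{\ln g}(\lambda)$ replaced by the one-sided boundary value $\phi^{\pm}_{\ln g}(\omega)=\pm\tfrac12\ln g(\omega)+\phi_{\ln g}(\omega)$. In particular the solution is unique. (b) If moreover $\ln g$ satisfies a Hölder condition on $\mathbb R$ of some order in $(0,1)$, then such a solution exists (and is hence given by the formula in (a)). -/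

import Mathlib

open Filter Topology
open scoped NNReal

/-- `g` satisfies a Hölder condition on the real line: `|g x - g y| ≤ C |x - y| ^ α` for all real
`x, y`, with some constant `C` and some exponent `0 < α ≤ 1`. -/
def SatisfiesHolder (g : ℝ → ℂ) : Prop :=
  ∃ C α : ℝ≥0, 0 < α ∧ α ≤ 1 ∧ HolderWith C α g

/-- Zero index on `ℝ`. The index on `ℝ` is the number of zeros minus the number of poles on `ℝ`;
a finite-valued continuous `g` has no poles there, so its index is zero exactly when it does not
vanish on `ℝ`. No condition at `±∞` is imposed. -/
def HasZeroIndex (g : ℝ → ℂ) : Prop :=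
  ∀ x : ℝ, g x ≠ 0

/-- `s` is the continuous logarithm `ln g` of `g` on the real line, normalized by `s 0 = 0`. -/
def IsContinuousLog (g s : ℝ → ℂ) : Prop :=
  Continuous s ∧ s 0 = 0 ∧ ∀ x : ℝ, Complex.exp (s x) = g x

/-- The Cauchy integral `1/(2πi) ∫ s(x)/(x - z) dx`, truncated to `|x| ≤ R` and to the complement
of the `ε`-neighbourhood of the singularity `z`. -/
noncomputable def truncatedSP (s : ℝ → ℂ) (z : ℂ) (ε R : ℝ) : ℂ :=
  (2 * Real.pi * Complex.I)⁻¹ *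
    ∫ x in {x : ℝ | |x| ≤ R ∧ ε ≤ ‖(x : ℂ) - z‖}, s x / ((x : ℂ) - z)

/-- The Sokhotskyi–Plemelj (principal value) integral `φ_s(z) = 1/(2πi) p.v.∫ s(x)/(x - z) dx`
converges and equals `v`. -/
def HasSP (s : ℝ → ℂ) (z v : ℂ) : Prop :=
  Tendsto (fun p : ℝ × ℝ => truncatedSP s z p.1 p.2) (𝓝[>] (0 : ℝ) ×ˢ atTop) (𝓝 v)

/-- The difference `φ_s(z) - φ_s(w)` of Sokhotskyi–Plemelj integrals, with a common principal value
at infinity, converges and equals `d`. -/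
def HasSPDiff (s : ℝ → ℂ) (z w d : ℂ) : Prop :=
  Tendsto (fun p : ℝ × ℝ => truncatedSP s z p.1 p.2 - truncatedSP s w p.1 p.2)
    (𝓝[>] (0 : ℝ) ×ˢ atTop) (𝓝 d)

/-- If both integrals converge separately, `HasSPDiff` is the difference of their values. -/
theorem HasSP.diff {s : ℝ → ℂ} {z w v u : ℂ} (hz : HasSP s z v) (hw : HasSP s w u) :
    HasSPDiff s z w (v - u) :=
  Tendsto.sub hz hw

/-- The open upper half-plane. -/
def upperHalf : Set ℂ := {z | 0 < z.im}

/-- The open lower half-plane. -/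
def lowerHalf : Set ℂ := {z | z.im < 0}

/-- `Φ` is analytic in `U` and continuous on `closure U`, and it has there a logarithm `L`, analytic
in `U` and continuous on `closure U`, with `L 0 = 0` (so `Φ 0 = 1`) and such that `L z / z` vanishes
at infinity in `closure U`. -/
def IsVanishingNormalized (U : Set ℂ) (Φ : ℂ → ℂ) : Prop :=
  DiffContOnCl ℂ Φ U ∧
    ∃ L : ℂ → ℂ, DiffContOnCl ℂ L U ∧ (∀ z ∈ closure U, Complex.exp (L z) = Φ z) ∧ L 0 = 0 ∧
      Tendsto (fun z => L z / z) (Bornology.cobounded ℂ ⊓ 𝓟 (closure U)) (𝓝 0)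

/-- `(Φp, Φm)` is a vanishing-normalized, sectionally analytic solution of the Riemann–Hilbert
problem `Φ⁺(ω) Φ⁻(ω) = g(ω)`, `ω ∈ ℝ`. -/
structure IsRHSolution (g : ℝ → ℂ) (Φp Φm : ℂ → ℂ) : Prop where
  upper : IsVanishingNormalized upperHalf Φp
  lower : IsVanishingNormalized lowerHalf Φm
  boundary : ∀ ω : ℝ, Φp ω * Φm ω = g ω

/-! Taking logarithms turns the multiplicative problem into an additive one. If `L⁺` and `L⁻` are
the normalized logarithms of a solution, then `L⁺ + L⁻` is a continuous logarithm of `g` on the line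
vanishing at 0. Such logarithms are unique, so `s = L⁺ + L⁻`.

Formula: by linearity it is enough to evaluate the Cauchy integral of the boundary values of a
single `L`, analytic in one half-plane and `o(|z|)` there. Since `L` may grow, `1/(x - z)` is
replaced by `1/(x - z) - 1/(x + i)`, which decays quadratically and makes the large arc negligible.
The counterterm does not involve `z`, so it cancels in `φ(z) - φ(0)`. Cauchy's theorem on
half-annuli then gives `L z`, `L z / 2` or `0` for `z` above, on or below the line
(`hasSPDiff_upperHalf`). The lower half-plane follows by `z ↦ -z`, which costs a sign. Adding the
two contributions isolates `L⁺` above and `-L⁻` below.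

Existence: for `s` Hölder of order `β < 1`, the Cauchy integral with kernel `1/(x - z) - x/(1 + x²)`
converges absolutely, and its derivative is `O(y^(β - 1))`, where `y = Im z`. By the
Hardy–Littlewood argument (`holder_of_deriv_le`) it is therefore Hölder of order `β`. So it extends
continuously to the closed half-plane and is `o(|z|)`. The same transform of `x ↦ s(-x)`, read at
`-z`, serves for the lower half-plane. The sum of the two at `x + iy` and `x - iy` is a Poisson
integral of `s`, which tends to `s x` (`norm_cauchyTransform_jump_le`). -/

theorem closure_upperHalf : closure upperHalf = {z : ℂ | 0 ≤ z.im} :=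
  Complex.closure_setOfPred_lt_im 0

theorem closure_lowerHalf : closure lowerHalf = {z : ℂ | z.im ≤ 0} :=
  Complex.closure_setOfPred_im_lt 0

theorem mem_closure_upperHalf {z : ℂ} : z ∈ closure upperHalf ↔ 0 ≤ z.im := by
  rw [closure_upperHalf]; rfl

theorem mem_closure_lowerHalf {z : ℂ} : z ∈ closure lowerHalf ↔ z.im ≤ 0 := by
  rw [closure_lowerHalf]; rfl

theorem isOpen_upperHalf : IsOpen upperHalf :=
  isOpen_lt continuous_const Complex.continuous_im

theorem ofReal_mem_closure_upperHalf (x : ℝ) : (x : ℂ) ∈ closure upperHalf :=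
  mem_closure_upperHalf.2 (by simp)

theorem ofReal_mem_closure_lowerHalf (x : ℝ) : (x : ℂ) ∈ closure lowerHalf :=
  mem_closure_lowerHalf.2 (by simp)

/-! ### Cauchy's theorem on half-annuli and principal values. -/

/-- The integral of `(w - ω) f(w)` with respect to the angle over the upper half circle of radius
`r` around `ω`. -/
noncomputable def halfArc (f : ℂ → ℂ) (ω r : ℝ) : ℂ :=
  ∫ θ in (0 : ℝ)..Real.pi, f (ω + r * Complex.exp (θ * Complex.I)) *
    (r * Complex.exp (θ * Complex.I))

theorem arc_im_nonneg {ω r θ : ℝ} (hr : 0 ≤ r) (hθ : θ ∈ Set.Icc 0 Real.pi) :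
    0 ≤ ((ω : ℂ) + r * Complex.exp (θ * Complex.I)).im := by
  simp only [Complex.add_im, Complex.ofReal_im, zero_add, Complex.im_ofReal_mul,
    Complex.exp_ofReal_mul_I_im]
  exact mul_nonneg hr (Real.sin_nonneg_of_mem_Icc hθ)

/-- The substitution `w = ω + exp ζ` carries the rectangle `[log ε, log R] × [0, π]` onto the
half-annulus, so Cauchy's theorem for rectangles applies. The horizontal sides become the two real
segments and the vertical sides the two arcs. -/
theorem half_annulus {f : ℂ → ℂ} {ω : ℝ}
    (hc : ContinuousOn f (closure upperHalf \ {(ω : ℂ)})) (hd : DifferentiableOn ℂ f upperHalf)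
    {ε R : ℝ} (hε : 0 < ε) (hR : ε ≤ R) :
    (∫ x in (ω - R)..(ω - ε), f x) + ∫ x in (ω + ε)..(ω + R), f x =
      Complex.I * halfArc f ω ε - Complex.I * halfArc f ω R := by
  have hR0 : 0 < R := hε.trans_le hR
  set G : ℂ → ℂ := fun ζ => f (ω + Complex.exp ζ) * Complex.exp ζ with hG
  have key := Complex.integral_boundary_rect_eq_zero_of_continuousOn_of_differentiableOn G
    (Real.log ε : ℂ) (Real.log R + Real.pi * Complex.I) ?_ ?_
  · simp only [Complex.ofReal_re, Complex.add_re, Complex.mul_re, Complex.ofReal_im, Complex.I_re,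
      Complex.I_im, Complex.add_im, Complex.mul_im, mul_zero, mul_one, sub_zero, zero_add, add_zero,
      zero_mul, Complex.ofReal_zero, smul_eq_mul] at key
    have e1 : (∫ x in Real.log ε..Real.log R, G x) = ∫ x in (ω + ε)..(ω + R), f x := by
      have h := intervalIntegral.integral_deriv_smul_comp' (a := Real.log ε) (b := Real.log R)
        (f := Real.exp) (f' := Real.exp) (g := fun u : ℝ => f (ω + u))
        (fun x _ => Real.hasDerivAt_exp x) Real.continuous_exp.continuousOn ?_
      · rw [Real.exp_log hε, Real.exp_log hR0] at h
        rw [← intervalIntegral.integral_comp_add_left (fun x : ℝ => f x)]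
        simp only [Complex.ofReal_add]
        rw [← h]
        refine intervalIntegral.integral_congr fun x _ => ?_
        simp [G, mul_comm]
      · refine hc.comp (by fun_prop) ?_
        rintro _ ⟨x, _, rfl⟩
        refine ⟨by exact_mod_cast ofReal_mem_closure_upperHalf (ω + Real.exp x), ?_⟩
        simp [Complex.exp_ne_zero]
    have e2 : -(∫ x in Real.log ε..Real.log R, G (x + Real.pi * Complex.I)) =
        ∫ x in (ω - R)..(ω - ε), f x := by
      have h := intervalIntegral.integral_deriv_smul_comp' (a := Real.log ε) (b := Real.log R)
        (f := Real.exp) (f' := Real.exp) (g := fun u : ℝ => f (ω - u))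
        (fun x _ => Real.hasDerivAt_exp x) Real.continuous_exp.continuousOn ?_
      · rw [Real.exp_log hε, Real.exp_log hR0] at h
        rw [← intervalIntegral.integral_comp_sub_left (fun x : ℝ => f x)]
        simp only [Complex.ofReal_sub]
        rw [← h, ← intervalIntegral.integral_neg]
        refine intervalIntegral.integral_congr fun x _ => ?_
        simp [G, Complex.exp_add, sub_eq_add_neg, mul_comm (f _)]
      · refine hc.comp (by fun_prop) ?_
        rintro _ ⟨x, _, rfl⟩
        refine ⟨by exact_mod_cast ofReal_mem_closure_upperHalf (ω - Real.exp x), ?_⟩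
        simp [Complex.exp_ne_zero]
    have e3 : ∀ r : ℝ, 0 < r → (∫ y in (0 : ℝ)..Real.pi, G (Real.log r + y * Complex.I)) =
        halfArc f ω r := by
      intro r hr
      refine intervalIntegral.integral_congr fun y _ => ?_
      simp [G, Complex.exp_add, ← Complex.ofReal_exp, Real.exp_log hr]
    rw [e1, e3 R hR0, e3 ε hε] at key
    rw [← e2]
    linear_combination key
  · refine ContinuousOn.mul ?_ Complex.continuous_exp.continuousOn
    refine hc.comp (by fun_prop) ?_
    intro ζ hζ
    rw [Complex.mem_reProdIm] at hζ
    have h2 := hζ.2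
    simp only [Complex.ofReal_im, Complex.add_im, Complex.mul_im, Complex.ofReal_re, Complex.I_im,
      Complex.I_re, mul_one, mul_zero, add_zero, zero_add, Set.uIcc_of_le Real.pi_pos.le] at h2
    refine ⟨mem_closure_upperHalf.2 ?_, by simp [Complex.exp_ne_zero]⟩
    simp only [Complex.add_im, Complex.ofReal_im, Complex.exp_im, zero_add]
    exact mul_nonneg (Real.exp_pos _).le (Real.sin_nonneg_of_mem_Icc h2)
  · refine DifferentiableOn.mul ?_ Complex.differentiable_exp.differentiableOn
    refine hd.comp (by fun_prop) ?_
    intro ζ hζ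
    rw [Complex.mem_reProdIm] at hζ
    have h2 := hζ.2
    simp only [Complex.ofReal_im, Complex.add_im, Complex.mul_im, Complex.ofReal_re, Complex.I_im,
      Complex.I_re, mul_one, mul_zero, add_zero, zero_add, min_eq_left Real.pi_pos.le,
      max_eq_right Real.pi_pos.le] at h2
    simp only [upperHalf, Set.mem_ofPred_eq, Complex.add_im, Complex.ofReal_im, Complex.exp_im,
      zero_add]
    exact mul_pos (Real.exp_pos _) (Real.sin_pos_of_mem_Ioo h2)

/-- Uniform closeness of `f w * (w - ω)` to `c` on the arc bounds the error by `π` times its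
supremum. The filter is left general to serve both the small arc at the pole and the large arc at
infinity. -/
theorem tendsto_halfArc {f : ℂ → ℂ} {ω : ℝ}
    (hc : ContinuousOn f (closure upperHalf \ {(ω : ℂ)})) {l : Filter ℝ} (hl : ∀ᶠ r in l, 0 < r)
    {c : ℂ} (h : ∀ δ > 0, ∀ᶠ r in l, ∀ w ∈ closure upperHalf, ‖w - ω‖ = r →
      ‖f w * (w - ω) - c‖ ≤ δ) :
    Tendsto (halfArc f ω) l (𝓝 (Real.pi * c)) := by
  rw [Metric.tendsto_nhds]
  intro δ hδ
  have hπ := Real.pi_pos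
  filter_upwards [hl, h (δ / (2 * Real.pi)) (by positivity)] with r hr hw
  have hmem : ∀ θ ∈ Set.Icc 0 Real.pi,
      (ω : ℂ) + r * Complex.exp (θ * Complex.I) ∈ closure upperHalf := fun θ hθ =>
    mem_closure_upperHalf.2 (arc_im_nonneg hr.le hθ)
  have hcont : ContinuousOn (fun θ : ℝ => f (ω + r * Complex.exp (θ * Complex.I)) *
      (r * Complex.exp (θ * Complex.I))) (Set.uIcc 0 Real.pi) := by
    rw [Set.uIcc_of_le hπ.le]
    refine ContinuousOn.mul (hc.comp (by fun_prop) fun θ hθ => ⟨hmem θ hθ, ?_⟩) (by fun_prop)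
    simp [Complex.exp_ne_zero, hr.ne']
  have e : halfArc f ω r - Real.pi * c = ∫ θ in (0 : ℝ)..Real.pi,
      (f (ω + r * Complex.exp (θ * Complex.I)) * (r * Complex.exp (θ * Complex.I)) - c) := by
    rw [intervalIntegral.integral_sub hcont.intervalIntegrable (by simp)]
    simp [halfArc]
  rw [dist_eq_norm, e]
  refine (intervalIntegral.norm_integral_le_of_norm_le_const (C := δ / (2 * Real.pi))
    fun θ hθ => ?_).trans_lt ?_
  · rw [Set.uIoc_of_le hπ.le] at hθ
    have := hw _ (hmem θ ⟨hθ.1.le, hθ.2⟩) (by simp [Complex.norm_exp_ofReal_mul_I, hr.le])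
    simpa using this
  · rw [sub_zero, abs_of_pos hπ]
    field_simp
    linarith

/-- Principal value at `ω` of the integral over the real line of a function analytic in the upper
half-plane with a simple pole at the boundary point `ω`. -/
theorem tendsto_principalValue {f : ℂ → ℂ} {ω : ℝ}
    (hc : ContinuousOn f (closure upperHalf \ {(ω : ℂ)})) (hd : DifferentiableOn ℂ f upperHalf)
    {c : ℂ} (hω : Tendsto (fun w => f w * (w - ω)) (𝓝[closure upperHalf \ {(ω : ℂ)}] ω) (𝓝 c))
    (hinf : Tendsto (fun w => w * f w) (Bornology.cobounded ℂ ⊓ 𝓟 (closure upperHalf)) (𝓝 0)) :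
    Tendsto (fun p : ℝ × ℝ => (∫ x in (-p.2)..(ω - p.1), f x) + ∫ x in (ω + p.1)..p.2, f x)
      (𝓝[>] (0 : ℝ) ×ˢ atTop) (𝓝 (Complex.I * Real.pi * c)) := by
  have hbound : ∀ δ > 0, ∃ M : ℝ, 0 < M ∧ ∀ w ∈ closure upperHalf, M ≤ ‖w‖ → ‖w‖ * ‖f w‖ ≤ δ := by
    intro δ hδ
    have h1 := (Metric.tendsto_nhds.1 hinf) δ hδ
    rw [eventually_inf_principal, ← comap_norm_atTop, eventually_comap] at h1
    obtain ⟨M, hM⟩ := eventually_atTop.1 h1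
    refine ⟨max M 1, by positivity, fun w hw hMw => ?_⟩
    have := hM ‖w‖ ((le_max_left _ _).trans hMw) w rfl hw
    rw [dist_zero_right, norm_mul] at this
    exact this.le
  have hint : ∀ a b : ℝ, (ω < a ∧ ω < b) ∨ (a < ω ∧ b < ω) →
      IntervalIntegrable (fun x : ℝ => f x) MeasureTheory.volume a b := by
    intro a b hab
    refine ContinuousOn.intervalIntegrable (hc.comp (by fun_prop) fun x hx =>
      ⟨ofReal_mem_closure_upperHalf x, ?_⟩)
    simp only [Set.mem_singleton_iff, Complex.ofReal_inj]
    rintro rfl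
    rw [Set.mem_uIcc] at hx
    grind
  have hsmall : Tendsto (fun ε : ℝ => Complex.I * halfArc f ω ε) (𝓝[>] 0)
      (𝓝 (Complex.I * (Real.pi * c))) := by
    refine (tendsto_halfArc hc self_mem_nhdsWithin fun δ hδ => ?_).const_mul _
    obtain ⟨η, hη, H⟩ := Metric.mem_nhdsWithin_iff.1 ((Metric.tendsto_nhds.1 hω) δ hδ)
    filter_upwards [Ioo_mem_nhdsGT hη] with r hr w hw hwr
    have : dist (f w * (w - ω)) c < δ := H ⟨by rw [Metric.mem_ball, dist_eq_norm, hwr]; exact hr.2,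
      hw, by
        rintro rfl
        simp at hwr
        exact hr.1.ne hwr⟩
    rw [dist_eq_norm] at this
    exact this.le
  have hlarge : Tendsto (fun R : ℝ => Complex.I * halfArc f ω R) atTop (𝓝 0) := by
    have : Tendsto (halfArc f ω) atTop (𝓝 (Real.pi * 0)) := by
      refine tendsto_halfArc hc (eventually_gt_atTop 0) fun δ hδ => ?_
      obtain ⟨M, hM0, hM⟩ := hbound (δ / 2) (by positivity)
      filter_upwards [eventually_ge_atTop (M + 2 * |ω|)] with r hr w hw hwr
      have h1 : ‖w - ω‖ ≤ ‖w‖ + |ω| := (norm_sub_le _ _).trans (by simp)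
      have h2 := hM w hw (by linarith [abs_nonneg ω])
      have h3 : ‖w - ω‖ ≤ 2 * ‖w‖ := by linarith [abs_nonneg ω]
      rw [sub_zero, norm_mul]
      nlinarith [norm_nonneg (f w)]
    simpa using this.const_mul Complex.I
  -- The half-annulus is centred at `ω`, but the truncation `|x| ≤ R` is centred at 0. The mismatch
  -- at each end is an interval of fixed length `|ω|`, on which `f` tends to 0.
  have hstrip : ∀ σ : ℝ, |σ| = 1 →
      Tendsto (fun R : ℝ => ∫ x in (ω + σ * R)..(σ * R), f x) atTop (𝓝 0) := by
    intro σ hσ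
    rw [Metric.tendsto_nhds]
    intro δ hδ
    obtain ⟨M, hM0, hM⟩ := hbound (δ / (2 * (|ω| + 1))) (by positivity)
    filter_upwards [eventually_ge_atTop (max M 1 + |ω|)] with R hR
    rw [dist_zero_right]
    refine (intervalIntegral.norm_integral_le_of_norm_le_const (C := δ / (2 * (|ω| + 1)))
      fun x hx => ?_).trans_lt ?_
    · have hx1 : |x - σ * R| ≤ |ω| := by
        have := Set.abs_sub_right_of_mem_uIcc (Set.uIoc_subset_uIcc hx)
        rw [abs_sub_comm]
        simpa using this
      have hR0 : 0 ≤ R := by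
        have := abs_nonneg ω
        have := le_max_right M 1
        linarith
      have hx2 : max M 1 ≤ |x| := by
        have h1 : |σ * R| = R := by rw [abs_mul, hσ, one_mul, abs_of_nonneg hR0]
        have h2 := abs_sub_abs_le_abs_sub (σ * R) x
        rw [abs_sub_comm] at h2
        linarith
      have h3 := hM x (ofReal_mem_closure_upperHalf x) (by
        simpa using (le_max_left _ _).trans hx2)
      have h4 : 1 ≤ ‖(x : ℂ)‖ := by simpa using (le_max_right _ _).trans hx2
      nlinarith [norm_nonneg (f x)]
    · have : |σ * R - (ω + σ * R)| = |ω| := by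
        rw [← abs_neg]; congr 1; ring
      rw [this, div_mul_eq_mul_div, div_lt_iff₀ (by positivity)]
      nlinarith [abs_nonneg ω]
  have hp := hstrip 1 (by simp)
  have hm := hstrip (-1) (by simp)
  have hlim := (((hsmall.comp tendsto_fst).sub (hlarge.comp (tendsto_snd (f := 𝓝[>] (0 : ℝ))))).sub
    (hm.comp (tendsto_snd (f := 𝓝[>] (0 : ℝ))))).add (hp.comp (tendsto_snd (f := 𝓝[>] (0 : ℝ))))
  rw [sub_zero, sub_zero, add_zero, ← mul_assoc] at hlim
  refine hlim.congr' ?_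
  have hev : ∀ᶠ p : ℝ × ℝ in 𝓝[>] (0 : ℝ) ×ˢ atTop, (0 < p.1 ∧ p.1 < 1) ∧ |ω| + 1 < p.2 :=
    Eventually.prod_mk (Ioo_mem_nhdsGT one_pos) (eventually_gt_atTop _)
  filter_upwards [hev] with ⟨ε, R⟩ ⟨⟨h0, h1⟩, hR⟩
  simp only at h0 h1 hR
  have hle := le_abs_self ω
  have hle' := neg_abs_le ω
  have hann := half_annulus hc hd h0 (by linarith [abs_nonneg ω] : ε ≤ R)
  simp only [Function.comp_apply, one_mul, neg_mul] at *
  rw [← hann]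
  have hn := intervalIntegral.integral_add_adjacent_intervals
    (hint (ω + -R) (-R) (Or.inr ⟨by linarith, by linarith⟩))
    (hint (-R) (ω - ε) (Or.inr ⟨by linarith, by linarith⟩))
  have hpp := intervalIntegral.integral_add_adjacent_intervals
    (hint (ω + ε) (ω + R) (Or.inl ⟨by linarith, by linarith⟩))
    (hint (ω + R) R (Or.inl ⟨by linarith, by linarith⟩))
  rw [← hpp, sub_eq_add_neg ω R, ← hn]
  ring

theorem tendsto_div_sub_cobounded (a : ℂ) :
    Tendsto (fun w : ℂ => w / (w - a)) (Bornology.cobounded ℂ) (𝓝 1) := by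
  have h : Tendsto (fun w : ℂ => (1 - a * w⁻¹)⁻¹) (Bornology.cobounded ℂ) (𝓝 (1 - a * 0)⁻¹) :=
    ((tendsto_inv₀_cobounded.const_mul a).const_sub 1).inv₀ (by simp)
  rw [mul_zero, sub_zero, inv_one] at h
  refine h.congr' ?_
  filter_upwards [Bornology.eventually_ne_cobounded (0 : ℂ),
    Bornology.eventually_ne_cobounded a] with w h0 ha
  have := sub_ne_zero.2 ha
  field_simp

theorem tendsto_intervalIntegral_shrink {h : ℝ → ℂ} (hh : Continuous h) (ω : ℝ) :
    Tendsto (fun ε : ℝ => ∫ x in (ω - ε)..(ω + ε), h x) (𝓝[>] 0) (𝓝 0) := by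
  have hp : Continuous fun b : ℝ => ∫ x in (0 : ℝ)..b, h x :=
    intervalIntegral.continuous_primitive (fun a b => hh.intervalIntegrable a b) 0
  have hc : Continuous fun ε : ℝ => (∫ x in (0 : ℝ)..(ω + ε), h x) - ∫ x in (0 : ℝ)..(ω - ε), h x :=
    (hp.comp (by fun_prop : Continuous fun ε : ℝ => ω + ε)).sub
      (hp.comp (by fun_prop : Continuous fun ε : ℝ => ω - ε))
  have := (hc.tendsto 0).mono_left (nhdsWithin_le_nhds (s := Set.Ioi 0))
  simp only [add_zero, sub_zero, sub_self] at this
  refine this.congr fun ε => ?_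
  exact intervalIntegral.integral_interval_sub_left (hh.intervalIntegrable _ _)
    (hh.intervalIntegrable _ _)

theorem continuous_restrict_real {f : ℂ → ℂ} {s : Set ℂ} (hc : ContinuousOn f s)
    (hs : ∀ x : ℝ, (x : ℂ) ∈ s) : Continuous fun x : ℝ => f x :=
  hc.comp_continuous Complex.continuous_ofReal hs

/-- The integral over the real line of a function analytic in the upper half-plane and
`o(1/|w|)` at infinity vanishes. -/
theorem tendsto_integral_zero {f : ℂ → ℂ} (hf : DiffContOnCl ℂ f upperHalf)
    (hinf : Tendsto (fun w => w * f w) (Bornology.cobounded ℂ ⊓ 𝓟 (closure upperHalf)) (𝓝 0)) :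
    Tendsto (fun R : ℝ => ∫ x in (-R)..R, f x) atTop (𝓝 0) := by
  have hcont := continuous_restrict_real hf.continuousOn ofReal_mem_closure_upperHalf
  have hpole : Tendsto (fun w => f w * (w - (0 : ℝ))) (𝓝[closure upperHalf \ {((0 : ℝ) : ℂ)}]
      ((0 : ℝ) : ℂ)) (𝓝 0) := by
    have h1 := (hf.continuousOn _ (ofReal_mem_closure_upperHalf 0)).tendsto.mono_left
      (nhdsWithin_mono _ (Set.sdiff_subset (t := {((0 : ℝ) : ℂ)})))
    have h2 : Tendsto (fun w : ℂ => w - (0 : ℝ)) (𝓝[closure upperHalf \ {((0 : ℝ) : ℂ)}]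
        ((0 : ℝ) : ℂ)) (𝓝 (((0 : ℝ) : ℂ) - (0 : ℝ))) :=
      (continuous_id.sub continuous_const).continuousAt.mono_left nhdsWithin_le_nhds
    simpa using h1.mul h2
  have h := (tendsto_principalValue (hf.continuousOn.mono Set.sdiff_subset) hf.differentiableOn
    hpole hinf).add ((tendsto_intervalIntegral_shrink hcont 0).comp
      (tendsto_fst (g := (atTop : Filter ℝ))))
  rw [mul_zero, add_zero] at h
  -- Once the hole around the artificial pole at 0 is filled in, the expression no longer depends on
  -- `ε`, and the product filter projects to `atTop`.
  have h' : Tendsto ((fun R : ℝ => ∫ x in (-R)..R, f x) ∘ Prod.snd) (𝓝[>] (0 : ℝ) ×ˢ atTop)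
      (𝓝 0) := by
    refine h.congr fun p => ?_
    have hi := fun a b : ℝ => hcont.intervalIntegrable (μ := MeasureTheory.volume) a b
    simp only [Function.comp_apply]
    rw [← intervalIntegral.integral_add_adjacent_intervals (hi (-p.2) (0 - p.1)) (hi _ p.2),
      ← intervalIntegral.integral_add_adjacent_intervals (hi (0 - p.1) (0 + p.1)) (hi _ p.2)]
    ring
  rwa [← tendsto_map'_iff, map_snd_prod] at h'

/-! ### The regularized Cauchy kernel and truncated integrals. -/

theorem ofReal_sub_ne_zero {z : ℂ} (hz : z.im ≠ 0) (x : ℝ) : (x : ℂ) - z ≠ 0 := by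
  intro h
  apply hz
  have := congrArg Complex.im h
  simpa using this

theorem add_I_ne_zero {w : ℂ} (hw : 0 ≤ w.im) : w + Complex.I ≠ 0 := by
  intro h
  have := congrArg Complex.im h
  simp at this
  linarith

theorem diffContOnCl_upperHalf_of_differentiableOn {f : ℂ → ℂ}
    (h : ∀ w : ℂ, 0 ≤ w.im → DifferentiableAt ℂ f w) : DiffContOnCl ℂ f upperHalf :=
  DifferentiableOn.diffContOnCl fun w hw =>
    (h w (mem_closure_upperHalf.1 hw)).differentiableWithinAt

/-- Moving the pole from `z` to `i` does not change the limit: after `x ↦ -x` the difference of the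
two kernels has both poles in the lower half-plane and decays quadratically. For the pole `i` the
kernel is `2i/(1 + x²)`, integrated by the arctangent. -/
theorem tendsto_integral_cauchyKernel {z : ℂ} (hz : 0 < z.im) :
    Tendsto (fun R : ℝ => ∫ x : ℝ in (-R)..R, (1 / ((x : ℂ) - z) - 1 / ((x : ℂ) + Complex.I)))
      atTop (𝓝 (2 * Real.pi * Complex.I)) := by
  have hne : ∀ w : ℂ, 0 ≤ w.im → ∀ a : ℂ, 0 < a.im → -w - a ≠ 0 := by
    intro w hw a ha h
    have := congrArg Complex.im h
    simp at this
    linarith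
  have h1 : Tendsto (fun R : ℝ => ∫ x : ℝ in (-R)..R,
      (1 / (-(x : ℂ) - z) - 1 / (-(x : ℂ) - Complex.I))) atTop (𝓝 0) := by
    refine tendsto_integral_zero (f := fun w => 1 / (-w - z) - 1 / (-w - Complex.I))
      (diffContOnCl_upperHalf_of_differentiableOn fun w hw => ?_) ?_
    · have h1 := hne w hw z hz
      have h2 := hne w hw Complex.I (by simp)
      fun_prop (disch := assumption)
    · have ha := (tendsto_div_sub_cobounded (-Complex.I)).sub (tendsto_div_sub_cobounded (-z))
      rw [sub_self] at ha
      refine (ha.mono_left inf_le_left).congr' ?_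
      filter_upwards [mem_inf_of_right (mem_principal_self _)] with w hw
      have hw' := mem_closure_upperHalf.1 hw
      have e1 : -w - z = -(w - -z) := by ring
      have e2 : -w - Complex.I = -(w - -Complex.I) := by ring
      rw [e1, e2, one_div_neg_eq_neg_one_div, one_div_neg_eq_neg_one_div]
      ring
  have h2 : Tendsto (fun R : ℝ => ∫ x : ℝ in (-R)..R,
      (1 / ((x : ℂ) - Complex.I) - 1 / ((x : ℂ) + Complex.I))) atTop
      (𝓝 (2 * Real.pi * Complex.I)) := by
    have e : ∀ R : ℝ, ∫ x : ℝ in (-R)..R,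
        (1 / ((x : ℂ) - Complex.I) - 1 / ((x : ℂ) + Complex.I)) =
        2 * Complex.I * ((Real.arctan R - Real.arctan (-R) : ℝ) : ℂ) := by
      intro R
      rw [← integral_inv_one_add_sq, ← intervalIntegral.integral_ofReal,
        ← intervalIntegral.integral_const_mul]
      refine intervalIntegral.integral_congr fun x _ => ?_
      have ha : (x : ℂ) - Complex.I ≠ 0 := ofReal_sub_ne_zero (by simp) x
      have hb : (x : ℂ) + Complex.I ≠ 0 := add_I_ne_zero (by simp)
      have hc : (1 : ℂ) + x ^ 2 = (x - Complex.I) * (x + Complex.I) := by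
        ring_nf
        simp [add_comm]
      push_cast
      rw [hc]
      field_simp
      ring
    simp only [e]
    have hT : Tendsto (fun R : ℝ => Real.arctan R - Real.arctan (-R)) atTop (𝓝 Real.pi) := by
      simp only [Real.arctan_neg, sub_neg_eq_add]
      have h := Real.tendsto_arctan_atTop.mono_right nhdsWithin_le_nhds
      have h' := h.add h
      rwa [add_halves] at h'
    have := ((Complex.continuous_ofReal.tendsto Real.pi).comp hT).const_mul (2 * Complex.I)
    rw [mul_right_comm] at this
    exact this
  have h3 := h1.add h2
  rw [zero_add] at h3
  refine h3.congr fun R => ?_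
  have hflip := intervalIntegral.integral_comp_neg (a := -R) (b := R)
    (fun x : ℝ => 1 / ((x : ℂ) - z) - 1 / ((x : ℂ) - Complex.I))
  simp only [Complex.ofReal_neg, neg_neg] at hflip
  have hI : ∀ x : ℝ, (x : ℂ) - Complex.I ≠ 0 := ofReal_sub_ne_zero (by simp)
  have hI' : ∀ x : ℝ, (x : ℂ) + Complex.I ≠ 0 := fun x => add_I_ne_zero (by simp)
  have hzz : ∀ x : ℝ, (x : ℂ) - z ≠ 0 := ofReal_sub_ne_zero hz.ne'
  rw [hflip, ← intervalIntegral.integral_add]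
  · refine intervalIntegral.integral_congr fun x _ => ?_
    ring
  · exact Continuous.intervalIntegrable (by fun_prop (disch := assumption)) _ _
  · exact Continuous.intervalIntegrable (by fun_prop (disch := assumption)) _ _

theorem truncation_real {ω ε R : ℝ} (hε : 0 < ε) (hR : |ω| + ε < R) :
    {x : ℝ | |x| ≤ R ∧ ε ≤ ‖(x : ℂ) - ω‖} = Set.Icc (-R) (ω - ε) ∪ Set.Icc (ω + ε) R := by
  have h1 := le_abs_self ω
  have h2 := neg_abs_le ω
  ext x
  simp only [← Complex.ofReal_sub, Complex.norm_real, Real.norm_eq_abs, Set.mem_ofPred_eq,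
    Set.mem_union, Set.mem_Icc, abs_le, le_abs]
  grind

theorem integrableOn_div_sub {s : ℝ → ℂ} (hs : Continuous s) {z : ℂ} {S : Set ℝ}
    (hS : IsCompact S) (hz : ∀ x ∈ S, (x : ℂ) - z ≠ 0) :
    MeasureTheory.IntegrableOn (fun x : ℝ => s x / ((x : ℂ) - z)) S := by
  refine ContinuousOn.integrableOn_compact hS ?_
  exact hs.continuousOn.div (by fun_prop) hz

theorem truncatedSP_real {s : ℝ → ℂ} (hs : Continuous s) {ω ε R : ℝ} (hε : 0 < ε)
    (hR : |ω| + ε < R) :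
    truncatedSP s ω ε R = (2 * Real.pi * Complex.I)⁻¹ *
      ((∫ x in (-R)..(ω - ε), s x / ((x : ℂ) - ω)) + ∫ x in (ω + ε)..R, s x / ((x : ℂ) - ω)) := by
  have h1 := le_abs_self ω
  have h2 := neg_abs_le ω
  have hne : ∀ x : ℝ, x ≠ ω → (x : ℂ) - ω ≠ 0 := fun x hx => by
    rw [← Complex.ofReal_sub]
    exact_mod_cast sub_ne_zero.2 hx
  rw [truncatedSP, truncation_real hε hR, MeasureTheory.setIntegral_union ?_ measurableSet_Icc
    (integrableOn_div_sub hs isCompact_Icc fun x hx => hne x (by rintro rfl; linarith [hx.2]))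
    (integrableOn_div_sub hs isCompact_Icc fun x hx => hne x (by rintro rfl; linarith [hx.1])),
    MeasureTheory.integral_Icc_eq_integral_Ioc, MeasureTheory.integral_Icc_eq_integral_Ioc,
    intervalIntegral.integral_of_le (by linarith), intervalIntegral.integral_of_le (by linarith)]
  rw [Set.disjoint_left]
  intro x hx hx'
  linarith [hx.2, hx'.1]

/-- Every real point is at distance at least `|z.im|` from `z`, so the truncation near `z` removes
nothing. -/
theorem truncatedSP_of_lt_im {s : ℝ → ℂ} {z : ℂ} {ε R : ℝ} (hε : ε < |z.im|) (hR : 0 ≤ R) :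
    truncatedSP s z ε R = (2 * Real.pi * Complex.I)⁻¹ * ∫ x in (-R)..R, s x / ((x : ℂ) - z) := by
  have : {x : ℝ | |x| ≤ R ∧ ε ≤ ‖(x : ℂ) - z‖} = Set.Icc (-R) R := by
    ext x
    simp only [Set.mem_ofPred_eq, Set.mem_Icc, ← abs_le, and_iff_left_iff_imp]
    intro _
    have := Complex.abs_im_le_norm ((x : ℂ) - z)
    simp at this
    linarith
  rw [truncatedSP, this, MeasureTheory.integral_Icc_eq_integral_Ioc,
    intervalIntegral.integral_of_le (by linarith)]

/-! ### Plemelj formulas for functions analytic in a half-plane. -/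

theorem tendsto_mul_cauchyKernel {L : ℂ → ℂ}
    (hinf : Tendsto (fun z => L z / z) (Bornology.cobounded ℂ ⊓ 𝓟 (closure upperHalf)) (𝓝 0))
    (z : ℂ) :
    Tendsto (fun w => w * (L w * (1 / (w - z) - 1 / (w + Complex.I))))
      (Bornology.cobounded ℂ ⊓ 𝓟 (closure upperHalf)) (𝓝 0) := by
  have h := ((hinf.mul ((tendsto_div_sub_cobounded z).mono_left inf_le_left)).mul
    ((tendsto_div_sub_cobounded (-Complex.I)).mono_left inf_le_left)).mul_const (z + Complex.I)
  rw [zero_mul, zero_mul, zero_mul] at h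
  refine h.congr' ?_
  filter_upwards [mem_inf_of_left (Bornology.eventually_ne_cobounded (0 : ℂ)),
    mem_inf_of_left (Bornology.eventually_ne_cobounded z),
    mem_inf_of_left (Bornology.eventually_ne_cobounded (-Complex.I))] with w h0 hz hI
  have h1 := sub_ne_zero.2 hz
  have h2 : w + Complex.I ≠ 0 := by simpa using sub_ne_zero.2 hI
  rw [sub_neg_eq_add]
  field_simp
  ring

theorem tendsto_integral_mul_kernel_of_im_neg {L : ℂ → ℂ} (hL : DiffContOnCl ℂ L upperHalf)
    (hinf : Tendsto (fun z => L z / z) (Bornology.cobounded ℂ ⊓ 𝓟 (closure upperHalf)) (𝓝 0))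
    {z : ℂ} (hz : z.im < 0) :
    Tendsto (fun R : ℝ => ∫ x in (-R)..R,
      L x * (1 / ((x : ℂ) - z) - 1 / ((x : ℂ) + Complex.I))) atTop (𝓝 0) := by
  have hk : DiffContOnCl ℂ (fun w => 1 / (w - z) - 1 / (w + Complex.I)) upperHalf := by
    refine diffContOnCl_upperHalf_of_differentiableOn fun w hw => ?_
    have h1 : w - z ≠ 0 := fun h => by
      have := congrArg Complex.im h
      simp at this
      linarith
    have h2 := add_I_ne_zero hw
    fun_prop (disch := assumption)
  exact tendsto_integral_zero (hL.smul hk) (tendsto_mul_cauchyKernel hinf z)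

/-- The pole is removed by writing `L w = L z + (w - z) * dslope L z w`. The divided difference
gives the analytic integrand `(z + i)/(w + i) * dslope L z w`, which is `o(1/|w|)` and contributes
0. The constant `L z` multiplies the integral of the bare kernel. -/
theorem tendsto_integral_mul_kernel_of_im_pos {L : ℂ → ℂ} (hL : DiffContOnCl ℂ L upperHalf)
    (hinf : Tendsto (fun z => L z / z) (Bornology.cobounded ℂ ⊓ 𝓟 (closure upperHalf)) (𝓝 0))
    {z : ℂ} (hz : 0 < z.im) :
    Tendsto (fun R : ℝ => ∫ x in (-R)..R,
      L x * (1 / ((x : ℂ) - z) - 1 / ((x : ℂ) + Complex.I))) atTop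
      (𝓝 (L z * (2 * Real.pi * Complex.I))) := by
  have hzU : upperHalf ∈ 𝓝 z := isOpen_upperHalf.mem_nhds hz
  have hcl : closure upperHalf ∈ 𝓝 z := mem_of_superset hzU subset_closure
  have hLz : DifferentiableAt ℂ L z := hL.differentiableAt isOpen_upperHalf hz
  have hq : DiffContOnCl ℂ (dslope L z) upperHalf :=
    ⟨(Complex.differentiableOn_dslope hzU).2 hL.differentiableOn,
      (continuousOn_dslope hcl).2 ⟨hL.continuousOn, hLz⟩⟩
  have hI : DiffContOnCl ℂ (fun w => (z + Complex.I) / (w + Complex.I)) upperHalf := by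
    refine diffContOnCl_upperHalf_of_differentiableOn fun w hw => ?_
    have h2 := add_I_ne_zero hw
    fun_prop (disch := assumption)
  have h1 := tendsto_integral_zero (hI.smul hq) (by
    have hc : Tendsto (fun w : ℂ => L z / w) (Bornology.cobounded ℂ ⊓ 𝓟 (closure upperHalf))
        (𝓝 0) := by
      have := (tendsto_inv₀_cobounded (α := ℂ)).const_mul (L z)
      rw [mul_zero] at this
      exact this.mono_left inf_le_left
    have h := (((hinf.sub hc).mul
      ((tendsto_div_sub_cobounded z).mono_left inf_le_left)).mul
      ((tendsto_div_sub_cobounded (-Complex.I)).mono_left inf_le_left)).mul_const (z + Complex.I)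
    rw [sub_zero, zero_mul, zero_mul, zero_mul] at h
    refine h.congr' ?_
    filter_upwards [mem_inf_of_left (Bornology.eventually_ne_cobounded (0 : ℂ)),
      mem_inf_of_left (Bornology.eventually_ne_cobounded z),
      mem_inf_of_left (Bornology.eventually_ne_cobounded (-Complex.I))] with w h0 hz hI
    have h1 := sub_ne_zero.2 hz
    have h2 : w + Complex.I ≠ 0 := by simpa using sub_ne_zero.2 hI
    rw [sub_neg_eq_add, dslope_of_ne _ hz, slope_def_field, smul_eq_mul]
    field_simp)
  have h2 := h1.add ((tendsto_integral_cauchyKernel hz).const_mul (L z))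
  rw [zero_add] at h2
  refine h2.congr fun R => ?_
  have hne : ∀ x : ℝ, (x : ℂ) - z ≠ 0 := ofReal_sub_ne_zero hz.ne'
  have hneI : ∀ x : ℝ, (x : ℂ) + Complex.I ≠ 0 := fun x => add_I_ne_zero (by simp)
  rw [← intervalIntegral.integral_const_mul, ← intervalIntegral.integral_add]
  · refine intervalIntegral.integral_congr fun x _ => ?_
    have h1 := hne x
    have h2 := hneI x
    simp only [smul_eq_mul]
    rw [dslope_of_ne _ (sub_ne_zero.1 h1), slope_def_field]
    field_simp
    ring
  · exact (continuous_restrict_real (hI.smul hq).continuousOn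
      ofReal_mem_closure_upperHalf).intervalIntegrable _ _
  · exact Continuous.intervalIntegrable (by fun_prop (disch := assumption)) _ _

/-- The subtracted integral is the part of the kernel that does not involve `z`. It may diverge as
`R → ∞`, but it is the same for every `z`, including real ones, and cancels in differences. -/
theorem tendsto_truncatedSP_sub_of_im_ne {L : ℂ → ℂ} (hL : DiffContOnCl ℂ L upperHalf)
    {z c : ℂ} (hz : z.im ≠ 0)
    (h : Tendsto (fun R : ℝ => ∫ x in (-R)..R,
      L x * (1 / ((x : ℂ) - z) - 1 / ((x : ℂ) + Complex.I))) atTop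
      (𝓝 (c * (2 * Real.pi * Complex.I)))) :
    Tendsto (fun p : ℝ × ℝ => truncatedSP (fun x => L x) z p.1 p.2 -
      (2 * Real.pi * Complex.I)⁻¹ * ∫ x in (-p.2)..p.2, L x / ((x : ℂ) + Complex.I))
      (𝓝[>] (0 : ℝ) ×ˢ atTop) (𝓝 c) := by
  have h' := (h.const_mul (2 * Real.pi * Complex.I)⁻¹).comp (tendsto_snd (f := 𝓝[>] (0 : ℝ)))
  have e : (2 * Real.pi * Complex.I)⁻¹ * (c * (2 * Real.pi * Complex.I)) = c := by
    have := Complex.two_pi_I_ne_zero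
    field_simp
  rw [e] at h'
  refine h'.congr' ?_
  filter_upwards [Eventually.prod_mk (Ioo_mem_nhdsGT (abs_pos.2 hz) : ∀ᶠ ε in 𝓝[>] (0 : ℝ), _)
    (eventually_ge_atTop (0 : ℝ))] with p hp
  rw [truncatedSP_of_lt_im hp.1.2 hp.2, Function.comp_apply, ← mul_sub,
    ← intervalIntegral.integral_sub]
  · congr 1
    refine intervalIntegral.integral_congr fun x _ => ?_
    ring
  · have hne : ∀ x : ℝ, (x : ℂ) - z ≠ 0 := ofReal_sub_ne_zero hz
    exact Continuous.intervalIntegrable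
      ((continuous_restrict_real hL.continuousOn ofReal_mem_closure_upperHalf).div
        (by fun_prop) hne) _ _
  · have hneI : ∀ x : ℝ, (x : ℂ) + Complex.I ≠ 0 := fun x => add_I_ne_zero (by simp)
    exact Continuous.intervalIntegrable
      ((continuous_restrict_real hL.continuousOn ofReal_mem_closure_upperHalf).div
        (by fun_prop) hneI) _ _

theorem tendsto_truncatedSP_sub_real {L : ℂ → ℂ} (hL : DiffContOnCl ℂ L upperHalf)
    (hinf : Tendsto (fun z => L z / z) (Bornology.cobounded ℂ ⊓ 𝓟 (closure upperHalf)) (𝓝 0))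
    (ω : ℝ) :
    Tendsto (fun p : ℝ × ℝ => truncatedSP (fun x => L x) ω p.1 p.2 -
      (2 * Real.pi * Complex.I)⁻¹ * ∫ x in (-p.2)..p.2, L x / ((x : ℂ) + Complex.I))
      (𝓝[>] (0 : ℝ) ×ˢ atTop) (𝓝 (L ω / 2)) := by
  have hcont := continuous_restrict_real hL.continuousOn ofReal_mem_closure_upperHalf
  have hneI : ∀ x : ℝ, (x : ℂ) + Complex.I ≠ 0 := fun x => add_I_ne_zero (by simp)
  have hcI : Continuous fun x : ℝ => L x / ((x : ℂ) + Complex.I) := hcont.div (by fun_prop) hneI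
  set f : ℂ → ℂ := fun w => L w * (1 / (w - ω) - 1 / (w + Complex.I)) with hf
  have hdiff : ∀ w : ℂ, 0 ≤ w.im → w ≠ ω →
      DifferentiableAt ℂ (fun w => 1 / (w - ω) - 1 / (w + Complex.I)) w := by
    intro w hw hne
    have h1 := sub_ne_zero.2 hne
    have h2 := add_I_ne_zero hw
    fun_prop (disch := assumption)
  have hpv := tendsto_principalValue (f := f) (ω := ω) (c := L ω) ?_ ?_ ?_
    (tendsto_mul_cauchyKernel hinf ω)
  -- The counterterm is integrated over all of `[-R, R]`, whereas `f` is integrated only outside the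
  -- hole. The discrepancy is an integral of a continuous function over the shrinking hole. The half
  -- residue `iπ L(ω)` divided by `2πi` gives `L(ω)/2`.
  · have hT := (hpv.add ((tendsto_intervalIntegral_shrink hcI ω).comp
      (tendsto_fst (g := (atTop : Filter ℝ)))).neg).const_mul (2 * Real.pi * Complex.I)⁻¹
    have e : (2 * Real.pi * Complex.I)⁻¹ * (Complex.I * Real.pi * L ω + -0) = L ω / 2 := by
      have h1 : (Real.pi : ℂ) ≠ 0 := by exact_mod_cast Real.pi_ne_zero
      field_simp
      ring
    rw [e] at hT
    refine hT.congr' ?_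
    filter_upwards [Eventually.prod_mk (Ioo_mem_nhdsGT one_pos : ∀ᶠ ε in 𝓝[>] (0 : ℝ), _)
      (eventually_gt_atTop (|ω| + 1))] with p hp
    obtain ⟨⟨h0, h1⟩, hR⟩ := hp
    have hle := le_abs_self ω
    have hle' := neg_abs_le ω
    rw [truncatedSP_real hcont h0 (by linarith), ← mul_sub]
    congr 1
    have hi := fun a b : ℝ => hcI.intervalIntegrable (μ := MeasureTheory.volume) a b
    have hsplit : ∀ a b : ℝ, (ω < a ∧ a ≤ b) ∨ (a ≤ b ∧ b < ω) → ∫ x in a..b, f x =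
        (∫ x in a..b, L x / ((x : ℂ) - ω)) - ∫ x in a..b, L x / ((x : ℂ) + Complex.I) := by
      intro a b hab
      rw [← intervalIntegral.integral_sub _ (hi a b)]
      · refine intervalIntegral.integral_congr fun x _ => ?_
        simp only [hf]
        ring
      · refine ContinuousOn.intervalIntegrable (hcont.continuousOn.div (by fun_prop) ?_)
        intro x hx
        rw [← Complex.ofReal_sub, Complex.ofReal_ne_zero, sub_ne_zero]
        rintro rfl
        rw [Set.mem_uIcc] at hx
        grind
    rw [hsplit _ _ (Or.inr ⟨by linarith, by linarith⟩),
      hsplit _ _ (Or.inl ⟨by linarith, by linarith⟩), Function.comp_apply,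
      ← intervalIntegral.integral_add_adjacent_intervals (hi (-p.2) (ω - p.1)) (hi _ p.2),
      ← intervalIntegral.integral_add_adjacent_intervals (hi (ω - p.1) (ω + p.1)) (hi _ p.2)]
    ring
  · refine (hL.continuousOn.mono Set.sdiff_subset).mul fun w hw => ?_
    exact (hdiff w (mem_closure_upperHalf.1 hw.1) hw.2).continuousAt.continuousWithinAt
  · refine hL.differentiableOn.mul fun w hw => ?_
    refine (hdiff w (le_of_lt hw) ?_).differentiableWithinAt
    rintro rfl
    simp [upperHalf] at hw
  · have h1 := (hL.continuousOn _ (ofReal_mem_closure_upperHalf ω)).tendsto.mono_left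
      (nhdsWithin_mono _ (Set.sdiff_subset (t := {(ω : ℂ)})))
    have h2 : ContinuousAt (fun w : ℂ => 1 - (w - ω) / (w + Complex.I)) ω :=
      continuousAt_const.sub ((continuousAt_id.sub continuousAt_const).div
        (continuousAt_id.add continuousAt_const) (hneI ω))
    have h3 := h1.mul
      (h2.tendsto.mono_left (nhdsWithin_le_nhds (s := closure upperHalf \ {(ω : ℂ)})))
    simp only [sub_self, zero_div, sub_zero, mul_one] at h3
    refine h3.congr' ?_
    filter_upwards [self_mem_nhdsWithin] with w hw
    have h4 : w - ω ≠ 0 := sub_ne_zero.2 hw.2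
    have h5 := add_I_ne_zero (mem_closure_upperHalf.1 hw.1)
    simp only [hf]
    field_simp

/-- The Sokhotskyi–Plemelj integral of the boundary values of a function analytic in the upper
half-plane. -/
theorem hasSPDiff_upperHalf {L : ℂ → ℂ} (hL : DiffContOnCl ℂ L upperHalf) (h0 : L 0 = 0)
    (hinf : Tendsto (fun z => L z / z) (Bornology.cobounded ℂ ⊓ 𝓟 (closure upperHalf)) (𝓝 0))
    (z : ℂ) :
    HasSPDiff (fun x => L x) z 0 (if 0 < z.im then L z else if z.im < 0 then 0 else L z / 2) := by
  have key : Tendsto (fun p : ℝ × ℝ => truncatedSP (fun x => L x) z p.1 p.2 -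
      (2 * Real.pi * Complex.I)⁻¹ * ∫ x in (-p.2)..p.2, L x / ((x : ℂ) + Complex.I))
      (𝓝[>] (0 : ℝ) ×ˢ atTop)
      (𝓝 (if 0 < z.im then L z else if z.im < 0 then 0 else L z / 2)) := by
    split_ifs with h1 h2
    · exact tendsto_truncatedSP_sub_of_im_ne hL h1.ne' (tendsto_integral_mul_kernel_of_im_pos hL hinf h1)
    · exact tendsto_truncatedSP_sub_of_im_ne hL h2.ne
        (by simpa using tendsto_integral_mul_kernel_of_im_neg hL hinf h2)
    · have hz : z = (z.re : ℂ) := Complex.ext (by simp) (by simp; linarith)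
      rw [hz]
      exact tendsto_truncatedSP_sub_real hL hinf z.re
  -- At the base point 0 the limit is `L 0 / 2 = 0`, so subtracting it removes the counterterm and
  -- leaves the value at `z` unchanged.
  have key0 := tendsto_truncatedSP_sub_real hL hinf 0
  rw [Complex.ofReal_zero, h0, zero_div] at key0
  have := key.sub key0
  rw [sub_zero] at this
  exact this.congr fun p => by ring

/-! ### Reflection to the lower half-plane and additivity in the density. -/

theorem truncatedSP_comp_neg (s : ℝ → ℂ) (z : ℂ) (ε R : ℝ) :
    truncatedSP (fun x => s (-x)) (-z) ε R = -truncatedSP s z ε R := by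
  have h := (MeasureTheory.Measure.measurePreserving_neg
    (MeasureTheory.volume : MeasureTheory.Measure ℝ)).setIntegral_preimage_emb
    (Homeomorph.neg ℝ).measurableEmbedding (fun x : ℝ => s x / ((x : ℂ) - z))
    {x : ℝ | |x| ≤ R ∧ ε ≤ ‖(x : ℂ) - z‖}
  have hset : (Neg.neg : ℝ → ℝ) ⁻¹' {x : ℝ | |x| ≤ R ∧ ε ≤ ‖(x : ℂ) - z‖} =
      {x : ℝ | |x| ≤ R ∧ ε ≤ ‖(x : ℂ) - -z‖} := by
    ext x
    simp only [Set.mem_preimage, Set.mem_ofPred_eq, abs_neg, Complex.ofReal_neg]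
    rw [← norm_neg, neg_sub', neg_neg]
  rw [truncatedSP, truncatedSP, ← h, ← mul_neg, ← MeasureTheory.integral_neg, hset]
  congr 2
  ext x
  rw [Complex.ofReal_neg, ← div_neg]
  congr 1
  ring

/-- The map `z ↦ -z` is holomorphic, exchanges the half-planes and reverses the sign of the Cauchy
integral, so the upper case applies to `w ↦ L (-w)`. -/
theorem hasSPDiff_lowerHalf {L : ℂ → ℂ} (hL : DiffContOnCl ℂ L lowerHalf) (h0 : L 0 = 0)
    (hinf : Tendsto (fun z => L z / z) (Bornology.cobounded ℂ ⊓ 𝓟 (closure lowerHalf)) (𝓝 0))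
    (z : ℂ) :
    HasSPDiff (fun x => L x) z 0
      (-(if z.im < 0 then L z else if 0 < z.im then 0 else L z / 2)) := by
  have hmaps : Set.MapsTo (Neg.neg : ℂ → ℂ) upperHalf lowerHalf := fun w hw => by
    simpa [lowerHalf, upperHalf] using hw
  have hM : DiffContOnCl ℂ (fun w => L (-w)) upperHalf :=
    hL.comp (differentiable_neg.diffContOnCl) hmaps
  have ht : Tendsto (Neg.neg : ℂ → ℂ) (Bornology.cobounded ℂ ⊓ 𝓟 (closure upperHalf))
      (Bornology.cobounded ℂ ⊓ 𝓟 (closure lowerHalf)) := by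
    refine tendsto_inf.2 ⟨tendsto_inf_left ?_, tendsto_inf_right (tendsto_principal_principal.2 ?_)⟩
    · exact tendsto_neg_cobounded
    · intro w hw
      rw [mem_closure_lowerHalf]
      simpa using mem_closure_upperHalf.1 hw
  have h := hasSPDiff_upperHalf hM (by simpa using h0) (by
    have := (hinf.comp ht).neg
    rw [neg_zero] at this
    refine this.congr fun w => ?_
    simp [div_neg]) (-z)
  have h' := Tendsto.neg h
  simp only [Complex.neg_im, neg_neg, Left.neg_pos_iff, Left.neg_neg_iff] at h'
  refine h'.congr fun p => ?_
  have e1 := truncatedSP_comp_neg (fun x : ℝ => L x) z p.1 p.2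
  have e2 := truncatedSP_comp_neg (fun x : ℝ => L x) 0 p.1 p.2
  simp only [Complex.ofReal_neg, neg_zero] at e1 e2
  rw [e1, e2]
  ring

theorem truncatedSP_add {s t : ℝ → ℂ} (hs : Continuous s) (ht : Continuous t) (z : ℂ) {ε : ℝ}
    (hε : 0 < ε) (R : ℝ) :
    truncatedSP (fun x => s x + t x) z ε R = truncatedSP s z ε R + truncatedSP t z ε R := by
  have hcpt : IsCompact {x : ℝ | |x| ≤ R ∧ ε ≤ ‖(x : ℂ) - z‖} := by
    refine (isCompact_Icc (a := -R) (b := R)).of_isClosed_subset ?_ fun x hx => abs_le.1 hx.1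
    exact (isClosed_le (f := fun x : ℝ => |x|) (g := fun _ => R) (by fun_prop) (by fun_prop)).inter
      (isClosed_le (f := fun _ : ℝ => ε) (g := fun x : ℝ => ‖(x : ℂ) - z‖) (by fun_prop)
        (by fun_prop))
  have hne : ∀ x ∈ {x : ℝ | |x| ≤ R ∧ ε ≤ ‖(x : ℂ) - z‖}, (x : ℂ) - z ≠ 0 := fun x hx =>
    norm_pos_iff.1 (hε.trans_le hx.2)
  simp only [truncatedSP, add_div]
  rw [MeasureTheory.integral_add (integrableOn_div_sub hs hcpt hne)
    (integrableOn_div_sub ht hcpt hne), mul_add]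

theorem HasSPDiff.add {s t : ℝ → ℂ} (hs : Continuous s) (ht : Continuous t) {z w c d : ℂ}
    (h1 : HasSPDiff s z w c) (h2 : HasSPDiff t z w d) :
    HasSPDiff (fun x => s x + t x) z w (c + d) := by
  refine (Tendsto.add h1 h2).congr' ?_
  filter_upwards [Eventually.prod_inl (self_mem_nhdsWithin : ∀ᶠ ε in 𝓝[>] (0 : ℝ), _) _] with p hp
  rw [truncatedSP_add hs ht z hp, truncatedSP_add hs ht w hp]
  ring

/-! ### Continuous logarithms and the solution formula. -/

/-- Two logarithms differ by `2πi` times a continuous integer-valued function, which is constant on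
the connected line and vanishes at 0. -/
theorem IsContinuousLog.unique {g s t : ℝ → ℂ} (hs : IsContinuousLog g s)
    (ht : IsContinuousLog g t) : s = t := by
  have h : ∀ x, ∃ n : ℤ, s x - t x = n * (2 * Real.pi * Complex.I) := fun x => by
    obtain ⟨n, hn⟩ := Complex.exp_eq_exp_iff_exists_int.1 ((hs.2.2 x).trans (ht.2.2 x).symm)
    exact ⟨n, by rw [hn]; ring⟩
  choose n hn using h
  have hpi := Real.pi_pos
  have hc : Continuous fun x => ((n x : ℤ) : ℝ) := by
    have : (fun x => ((n x : ℤ) : ℝ)) = fun x => (s x - t x).im / (2 * Real.pi) := by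
      ext x
      rw [hn]
      simp
    rw [this]
    exact (Complex.continuous_im.comp (hs.1.sub ht.1)).div_const _
  have hc' : Continuous n := Int.isClosedEmbedding_coe_real.isEmbedding.continuous_iff.2 hc
  ext x
  have h0 : n x = n 0 := PreconnectedSpace.constant inferInstance hc'
  have h1 := hn 0
  rw [hs.2.1, ht.2.1, sub_zero] at h1
  rw [← sub_eq_zero, hn x, h0, ← h1]

theorem exists_isContinuousLog {g : ℝ → ℂ} (hg : Continuous g) (hindex : HasZeroIndex g)
    (hg0 : g 0 = 1) : ∃ s, IsContinuousLog g s := by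
  -- The logarithm is the lift of `g` through the covering `exp : ℂ → ℂ \ {0}` that starts at 0.
  obtain ⟨F, ⟨hF0, hF⟩, -⟩ := Complex.isCoveringMap_exp.existsUnique_continuousMap_lifts
    ⟨fun x : ℝ => (⟨g x, hindex x⟩ : {z : ℂ // z ≠ 0}), by fun_prop⟩ 0 0 (by ext; simp [hg0])
  exact ⟨F, F.continuous, hF0, fun x => congrArg Subtype.val (congrFun hF x)⟩

theorem SatisfiesHolder.continuous {g : ℝ → ℂ} (h : SatisfiesHolder g) : Continuous g := by
  obtain ⟨C, α, hα, -, h⟩ := h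
  exact h.continuous hα

theorem HasSPDiff.unique {s : ℝ → ℂ} {z w c d : ℂ} (h : HasSPDiff s z w c)
    (h' : HasSPDiff s z w d) : c = d :=
  tendsto_nhds_unique h h'

/-- Every vanishing-normalized solution is given by the Sokhotskyi–Plemelj integral. -/
theorem IsRHSolution.formula {g s : ℝ → ℂ} (hs : IsContinuousLog g s) {Φp Φm : ℂ → ℂ}
    (h : IsRHSolution g Φp Φm) :
    (∀ z : ℂ, z.im ≠ 0 → ∃ d : ℂ, HasSPDiff s z 0 d ∧
      (0 < z.im → Φp z = Complex.exp d) ∧ (z.im < 0 → Φm z = Complex.exp (-d))) ∧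
    (∀ ω : ℝ, ∃ d : ℂ, HasSPDiff s ω 0 d ∧
      Φp ω = Complex.exp (s ω / 2 + d) ∧ Φm ω = Complex.exp (-(-(s ω) / 2 + d))) ∧
    (∀ z v v₀ : ℂ, HasSP s z v → HasSP s 0 v₀ →
      (0 < z.im → Φp z = Complex.exp (v - v₀)) ∧
      (z.im < 0 → Φm z = Complex.exp (-v + v₀))) := by
  obtain ⟨-, Lp, hLp, hexp, hp0, hpinf⟩ := h.upper
  obtain ⟨-, Lm, hLm, hexm, hm0, hminf⟩ := h.lower
  have hcp := continuous_restrict_real hLp.continuousOn ofReal_mem_closure_upperHalf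
  have hcm := continuous_restrict_real hLm.continuousOn ofReal_mem_closure_lowerHalf
  -- This identity makes the problem additive: both sides are normalized continuous logarithms of
  -- `g`.
  obtain rfl : s = fun x : ℝ => Lp x + Lm x := by
    refine hs.unique ⟨hcp.add hcm, by simp [hp0, hm0], fun x => ?_⟩
    rw [Complex.exp_add, hexp _ (ofReal_mem_closure_upperHalf x),
      hexm _ (ofReal_mem_closure_lowerHalf x), h.boundary]
  have key := fun z => HasSPDiff.add hcp hcm (hasSPDiff_upperHalf hLp hp0 hpinf z)
    (hasSPDiff_lowerHalf hLm hm0 hminf z)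
  have hpos : ∀ z : ℂ, 0 < z.im → HasSPDiff (fun x : ℝ => Lp x + Lm x) z 0 (Lp z) := by
    intro z hz
    simpa [hz, hz.not_gt] using key z
  have hneg : ∀ z : ℂ, z.im < 0 → HasSPDiff (fun x : ℝ => Lp x + Lm x) z 0 (-Lm z) := by
    intro z hz
    simpa [hz, hz.not_gt] using key z
  refine ⟨fun z hz => ?_, fun ω => ?_, fun z v v₀ hv hv₀ => ⟨fun hz => ?_, fun hz => ?_⟩⟩
  · rcases hz.lt_or_gt with hz | hz
    · refine ⟨_, hneg z hz, fun h => absurd h hz.not_gt, fun _ => ?_⟩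
      rw [neg_neg, hexm _ (subset_closure hz)]
    · refine ⟨_, hpos z hz, fun _ => ?_, fun h => absurd h hz.not_gt⟩
      rw [hexp _ (subset_closure hz)]
  -- Here `d = Lp ω / 2 - Lm ω / 2`; adding or subtracting half of `s ω = Lp ω + Lm ω` leaves `Lp ω`
  -- or `-Lm ω`.
  · refine ⟨_, key ω, ?_, ?_⟩
    · rw [← hexp _ (ofReal_mem_closure_upperHalf ω)]
      congr 1
      simp
      ring
    · rw [← hexm _ (ofReal_mem_closure_lowerHalf ω)]
      congr 1
      simp
      ring
  · rw [(hv.diff hv₀).unique (hpos z hz), hexp _ (subset_closure hz)]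
  · have := (hv.diff hv₀).unique (hneg z hz)
    rw [neg_add_eq_sub, ← neg_sub, this, neg_neg, hexm _ (subset_closure hz)]

/-! ### Weighted integrals and kernel estimates for Hölder densities. -/

theorem integrable_rpow_mul_inv_one_add_sq {β : ℝ} (hβ : 0 < β) (hβ1 : β < 1) :
    MeasureTheory.Integrable fun x : ℝ => |x| ^ β * (1 + x ^ 2)⁻¹ := by
  have h := integrable_rpow_neg_one_add_norm_sq (E := ℝ) (μ := MeasureTheory.volume)
    (r := 2 - β) (by simp; linarith)
  refine h.mono' ?_ (Eventually.of_forall fun x => ?_)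
  · exact Continuous.aestronglyMeasurable (((continuous_abs).rpow_const
      fun _ => Or.inr hβ.le).mul (Continuous.inv₀ (by fun_prop) fun x => by positivity))
  · have h1 : (0 : ℝ) < 1 + x ^ 2 := by positivity
    have h2 : |x| ^ β ≤ (1 + x ^ 2) ^ (β / 2) := by
      have : |x| ^ β = (x ^ 2) ^ (β / 2) := by
        rw [← sq_abs, ← Real.rpow_natCast_mul (abs_nonneg x)]
        congr 1
        push_cast
        ring
      rw [this]
      exact Real.rpow_le_rpow (by positivity) (by linarith) (by positivity)
    have e : (1 + ‖x‖ ^ 2) ^ (-(2 - β) / 2) = (1 + x ^ 2) ^ (β / 2) * (1 + x ^ 2)⁻¹ := by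
      rw [Real.norm_eq_abs, sq_abs, ← Real.rpow_neg_one, ← Real.rpow_add h1]
      congr 1
      ring
    rw [e, Real.norm_of_nonneg (by positivity)]
    gcongr

theorem scaled_rpow_div {β y : ℝ} (hy : 0 < y) (u : ℝ) :
    |y * u| ^ β / ((y * u) ^ 2 + y ^ 2) = y ^ (β - 2) * (|u| ^ β * (1 + u ^ 2)⁻¹) := by
  rw [abs_mul, abs_of_pos hy, Real.mul_rpow hy.le (abs_nonneg u), Real.rpow_sub hy,
    Real.rpow_two]
  have : (1 : ℝ) + u ^ 2 ≠ 0 := by positivity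
  have h2 : (y * u) ^ 2 + y ^ 2 = y ^ 2 * (1 + u ^ 2) := by ring
  rw [h2]
  field_simp

/-- The scaling `x = a + y u` produces the power `y ^ (β - 1)`, which is the source of the
derivative bound on the Cauchy integral. The case `β = 0` gives the mass of the Poisson kernel. -/
theorem integral_rpow_div {β y : ℝ} (hy : 0 < y) (a : ℝ) :
    ∫ x : ℝ, |x - a| ^ β / ((x - a) ^ 2 + y ^ 2) =
      y ^ (β - 1) * ∫ u : ℝ, |u| ^ β * (1 + u ^ 2)⁻¹ := by
  rw [MeasureTheory.integral_sub_right_eq_self (fun x : ℝ => |x| ^ β / (x ^ 2 + y ^ 2)) a]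
  have h := MeasureTheory.Measure.integral_comp_mul_left
    (fun x : ℝ => |x| ^ β / (x ^ 2 + y ^ 2)) y
  simp only [scaled_rpow_div hy, MeasureTheory.integral_const_mul, smul_eq_mul] at h
  rw [abs_of_pos (inv_pos.2 hy), eq_inv_mul_iff_mul_eq₀ hy.ne'] at h
  have e : y ^ (β - 1) = y * y ^ (β - 2) := by
    conv_rhs => rw [← Real.rpow_one y, ← Real.rpow_mul hy.le, one_mul, ← Real.rpow_add hy]
    congr 1
    ring
  rw [← h, e, mul_assoc]

theorem integrable_rpow_div {β y : ℝ} (hβ : 0 < β) (hβ1 : β < 1) (hy : 0 < y) (a : ℝ) :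
    MeasureTheory.Integrable fun x : ℝ => |x - a| ^ β / ((x - a) ^ 2 + y ^ 2) := by
  refine MeasureTheory.Integrable.comp_sub_right (f := fun x : ℝ => |x| ^ β / (x ^ 2 + y ^ 2)) ?_ a
  rw [← MeasureTheory.integrable_comp_mul_left_iff _ hy.ne']
  simp only [scaled_rpow_div hy]
  exact (integrable_rpow_mul_inv_one_add_sq hβ hβ1).const_mul _

theorem norm_ofReal_sub_sq (x : ℝ) (z : ℂ) :
    ‖(x : ℂ) - z‖ ^ 2 = (x - z.re) ^ 2 + z.im ^ 2 := by
  rw [Complex.sq_norm, Complex.normSq_apply]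
  simp
  ring

/-- The constant depends on `w` only through `y` and `M`, so `1/‖x - w‖²` has an integrable majorant
uniform near a point; this allows differentiation under the integral. -/
theorem one_add_sq_le {y M : ℝ} (hy : 0 < y) {w : ℂ} (hw : y ≤ w.im) (hM : ‖w‖ ≤ M) (x : ℝ) :
    1 + x ^ 2 ≤ (1 / y ^ 2 + (1 + M / y) ^ 2) * ‖(x : ℂ) - w‖ ^ 2 := by
  have h1 : y ≤ ‖(x : ℂ) - w‖ := by
    have := Complex.abs_im_le_norm ((x : ℂ) - w)
    simp at this
    exact hw.trans ((le_abs_self _).trans this)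
  have h2 : |x| ≤ ‖(x : ℂ) - w‖ + M := by
    have := norm_add_le ((x : ℂ) - w) w
    simp at this
    linarith
  have hM0 : 0 ≤ M := (norm_nonneg w).trans hM
  set n := ‖(x : ℂ) - w‖
  have h3 : |x| ≤ (1 + M / y) * n := by
    have : M ≤ M / y * n := by
      rw [div_mul_eq_mul_div, le_div_iff₀ hy]
      gcongr
    linarith
  have h4 : x ^ 2 ≤ ((1 + M / y) * n) ^ 2 := by
    rw [← sq_abs]
    gcongr
  have h5 : 1 ≤ 1 / y ^ 2 * n ^ 2 := by
    rw [one_div, inv_mul_eq_div, one_le_div (by positivity)]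
    gcongr
  nlinarith

/-! ### The Cauchy transform of a Hölder density and its derivative. -/

/-- The Cauchy integral of `s` with a kernel regularized at infinity. -/
noncomputable def cauchyTransform (s : ℝ → ℂ) (z : ℂ) : ℂ :=
  (2 * Real.pi * Complex.I)⁻¹ * ∫ x : ℝ, s x * (1 / ((x : ℂ) - z) - x / (1 + (x : ℂ) ^ 2))

theorem one_add_ofReal_sq_ne_zero (x : ℝ) : 1 + (x : ℂ) ^ 2 ≠ 0 := by
  have : (1 : ℝ) + x ^ 2 ≠ 0 := by positivity
  exact_mod_cast this

theorem continuous_of_holder {s : ℝ → ℂ} {C β : ℝ} (hβ : 0 < β)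
    (hs : ∀ x y, ‖s x - s y‖ ≤ C * |x - y| ^ β) : Continuous s := by
  refine continuous_iff_continuousAt.2 fun a => ?_
  rw [ContinuousAt, tendsto_iff_norm_sub_tendsto_zero]
  have h : Continuous fun x : ℝ => C * |x - a| ^ β :=
    continuous_const.mul ((by fun_prop : Continuous fun x : ℝ => |x - a|).rpow_const
      fun _ => Or.inr hβ.le)
  have h' := h.tendsto a
  simp only [sub_self, abs_zero, Real.zero_rpow hβ.ne', mul_zero] at h'
  exact squeeze_zero (fun _ => norm_nonneg _) (fun x => hs x a) h'

section CauchyTransform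

variable {s : ℝ → ℂ} {C β : ℝ} (hβ : 0 < β) (hβ1 : β < 1)
  (hs : ∀ x y, ‖s x - s y‖ ≤ C * |x - y| ^ β) (h0 : s 0 = 0)

include hs h0 in
theorem norm_le_of_holder (x : ℝ) : ‖s x‖ ≤ C * |x| ^ β := by
  simpa [h0] using hs x 0

include hβ hβ1 hs h0

theorem integrable_cauchyTransform {z : ℂ} (hz : 0 < z.im) :
    MeasureTheory.Integrable fun x : ℝ =>
      s x * (1 / ((x : ℂ) - z) - x / (1 + (x : ℂ) ^ 2)) := by
  have hne : ∀ x : ℝ, (x : ℂ) - z ≠ 0 := ofReal_sub_ne_zero hz.ne'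
  have hcont := continuous_of_holder hβ hs
  refine ((integrable_rpow_mul_inv_one_add_sq hβ hβ1).const_mul
    (C * (‖z‖ + ‖1 + z ^ 2‖ / z.im))).mono' ?_ (Eventually.of_forall fun x => ?_)
  · have := one_add_ofReal_sq_ne_zero
    exact Continuous.aestronglyMeasurable (by fun_prop (disch := assumption))
  -- This form displays the kernel as a bounded factor times `1/(1 + x²)`, which absorbs the growth
  -- `|x| ^ β` of `s`.
  · have e : 1 / ((x : ℂ) - z) - x / (1 + (x : ℂ) ^ 2) =
        (z + (1 + z ^ 2) / (x - z)) * (1 + (x : ℂ) ^ 2)⁻¹ := by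
      have h1 := hne x
      have h2 := one_add_ofReal_sq_ne_zero x
      field_simp
      ring
    have h1 : z.im ≤ ‖(x : ℂ) - z‖ := by
      have := Complex.abs_im_le_norm ((x : ℂ) - z)
      simp at this
      exact (le_abs_self _).trans this
    have h2 : ‖z + (1 + z ^ 2) / ((x : ℂ) - z)‖ ≤ ‖z‖ + ‖1 + z ^ 2‖ / z.im := by
      refine (norm_add_le _ _).trans ?_
      rw [norm_div]
      gcongr
    have h3 : ‖(1 + (x : ℂ) ^ 2)⁻¹‖ = (1 + x ^ 2)⁻¹ := by
      rw [norm_inv]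
      congr 1
      rw [← Complex.ofReal_one, ← Complex.ofReal_pow, ← Complex.ofReal_add, Complex.norm_real,
        Real.norm_of_nonneg (by positivity)]
    rw [e, norm_mul, norm_mul, h3]
    calc ‖s x‖ * (‖z + (1 + z ^ 2) / ((x : ℂ) - z)‖ * (1 + x ^ 2)⁻¹)
        ≤ (C * |x| ^ β) * ((‖z‖ + ‖1 + z ^ 2‖ / z.im) * (1 + x ^ 2)⁻¹) := by
          gcongr
          · exact (norm_nonneg _).trans (norm_le_of_holder hs h0 x)
          · exact norm_le_of_holder hs h0 x
      _ = _ := by ring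

theorem hasDerivAt_cauchyTransform {z : ℂ} (hz : 0 < z.im) :
    HasDerivAt (cauchyTransform s)
      ((2 * Real.pi * Complex.I)⁻¹ * ∫ x : ℝ, s x * (1 / ((x : ℂ) - z) ^ 2)) z := by
  have hcont := continuous_of_holder hβ hs
  set y := z.im / 2 with hy
  have hy0 : 0 < y := by positivity
  have him : ∀ w ∈ Metric.ball z y, y ≤ w.im ∧ ‖w‖ ≤ ‖z‖ + y := by
    intro w hw
    rw [Metric.mem_ball, dist_eq_norm] at hw
    constructor
    · have := (abs_le.1 (Complex.abs_im_le_norm (w - z))).1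
      rw [Complex.sub_im] at this
      linarith
    · have := norm_add_le (w - z) z
      rw [sub_add_cancel] at this
      linarith
  set K := 1 / y ^ 2 + (1 + (‖z‖ + y) / y) ^ 2
  have hne : ∀ x : ℝ, (x : ℂ) - z ≠ 0 := ofReal_sub_ne_zero hz.ne'
  have hev : ∀ᶠ w in 𝓝 z, 0 < w.im :=
    (isOpen_lt continuous_const Complex.continuous_im).mem_nhds hz
  refine HasDerivAt.const_mul _ (hasDerivAt_integral_of_dominated_loc_of_deriv_le
    (F := fun w (x : ℝ) => s x * (1 / ((x : ℂ) - w) - x / (1 + (x : ℂ) ^ 2)))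
    (F' := fun w (x : ℝ) => s x * (1 / ((x : ℂ) - w) ^ 2))
    (bound := fun x => C * K * (|x| ^ β * (1 + x ^ 2)⁻¹))
    (Metric.ball_mem_nhds z hy0) ?_ (integrable_cauchyTransform hβ hβ1 hs h0 hz) ?_ ?_ ?_ ?_).2
  · filter_upwards [hev] with w hw
    exact (integrable_cauchyTransform hβ hβ1 hs h0 hw).aestronglyMeasurable
  · have : ∀ x : ℝ, ((x : ℂ) - z) ^ 2 ≠ 0 := fun x => pow_ne_zero _ (hne x)
    exact Continuous.aestronglyMeasurable (by fun_prop (disch := assumption))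
  · refine Eventually.of_forall fun x w hw => ?_
    obtain ⟨h1, h2⟩ := him w hw
    have h3 := one_add_sq_le hy0 h1 h2 x
    have h4 : 0 < ‖(x : ℂ) - w‖ ^ 2 :=
      pow_pos (norm_pos_iff.2 (ofReal_sub_ne_zero (hy0.trans_le h1).ne' x)) 2
    have h5 : 1 / ‖(x : ℂ) - w‖ ^ 2 ≤ K * (1 + x ^ 2)⁻¹ := by
      rw [div_le_iff₀ h4, mul_right_comm, ← div_eq_mul_inv, one_le_div (by positivity)]
      exact h3
    rw [norm_mul, norm_div, norm_one, norm_pow]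
    calc ‖s x‖ * (1 / ‖(x : ℂ) - w‖ ^ 2) ≤ (C * |x| ^ β) * (K * (1 + x ^ 2)⁻¹) := by
          gcongr
          · exact (norm_nonneg _).trans (norm_le_of_holder hs h0 x)
          · exact norm_le_of_holder hs h0 x
      _ = _ := by ring
  · exact (integrable_rpow_mul_inv_one_add_sq hβ hβ1).const_mul _
  · refine Eventually.of_forall fun x w hw => ?_
    have h1 : (x : ℂ) - w ≠ 0 := ofReal_sub_ne_zero (hy0.trans_le (him w hw).1).ne' x
    have h2 : HasDerivAt (fun w : ℂ => (x : ℂ) - w) (-1) w := by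
      simpa using (hasDerivAt_id w).const_sub (x : ℂ)
    have h3 := ((h2.inv h1).sub_const ((x : ℂ) / (1 + (x : ℂ) ^ 2))).const_mul (s x)
    simpa [one_div] using h3

end CauchyTransform

theorem integrable_one_div_sub_sq {z : ℂ} (hz : 0 < z.im) :
    MeasureTheory.Integrable fun x : ℝ => 1 / ((x : ℂ) - z) ^ 2 := by
  have hne : ∀ x : ℝ, ((x : ℂ) - z) ^ 2 ≠ 0 := fun x => pow_ne_zero _ (ofReal_sub_ne_zero hz.ne' x)
  refine ((integrable_inv_one_add_sq).const_mul
    (1 / z.im ^ 2 + (1 + ‖z‖ / z.im) ^ 2)).mono' ?_ (Eventually.of_forall fun x => ?_)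
  · exact Continuous.aestronglyMeasurable (by fun_prop (disch := assumption))
  · have h := one_add_sq_le hz le_rfl le_rfl x
    rw [norm_div, norm_one, norm_pow, div_le_iff₀ (by simpa using norm_pos_iff.2 (hne x)),
      mul_right_comm, ← div_eq_mul_inv, one_le_div (by positivity)]
    exact h

/-- The antiderivative `-1/(x - z)` vanishes at both ends. Hence a constant can be subtracted from
the density in the derivative of the Cauchy integral. -/
theorem integral_one_div_sub_sq {z : ℂ} (hz : 0 < z.im) :
    ∫ x : ℝ, 1 / ((x : ℂ) - z) ^ 2 = 0 := by
  have hlim : ∀ l : Filter ℝ, Tendsto (fun x : ℝ => (x : ℂ)) l (Bornology.cobounded ℂ) →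
      Tendsto (fun x : ℝ => -((x : ℂ) - z)⁻¹) l (𝓝 0) := by
    intro l hl
    have h := (tendsto_inv₀_cobounded (α := ℂ)).comp ((tendsto_sub_const_cobounded z).comp hl)
    simpa using h.neg
  have hco : ∀ l : Filter ℝ, Tendsto (fun x : ℝ => |x|) l atTop →
      Tendsto (fun x : ℝ => (x : ℂ)) l (Bornology.cobounded ℂ) := by
    intro l hl
    rw [← tendsto_norm_atTop_iff_cobounded]
    simpa using hl
  have := MeasureTheory.integral_of_hasDerivAt_of_tendsto
    (f := fun x : ℝ => -((x : ℂ) - z)⁻¹) (f' := fun x : ℝ => 1 / ((x : ℂ) - z) ^ 2) (fun x => ?_)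
    (integrable_one_div_sub_sq hz) (hlim _ (hco _ tendsto_abs_atBot_atTop))
    (hlim _ (hco _ tendsto_abs_atTop_atTop))
  · simpa using this
  · have h := (((hasDerivAt_id (x : ℂ)).sub_const z).inv
      (ofReal_sub_ne_zero hz.ne' x)).neg.comp_ofReal
    simpa [neg_div] using h

/-- Only the modulus of the kernel matters, so one estimate covers both the differentiated Cauchy
kernel `1/(x - z)²` and the Poisson kernel up to its factor `y/π`. -/
theorem norm_integral_holder_div_le {s : ℝ → ℂ} {C β : ℝ} (hβ : 0 < β) (hβ1 : β < 1)
    (hs : ∀ x y, ‖s x - s y‖ ≤ C * |x - y| ^ β) {z : ℂ} (hz : 0 < z.im) {k : ℝ → ℂ}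
    (hk : ∀ x, ‖k x‖ = 1 / ‖(x : ℂ) - z‖ ^ 2) :
    ‖∫ x : ℝ, (s x - s z.re) * k x‖ ≤
      C * (z.im ^ (β - 1) * ∫ u : ℝ, |u| ^ β * (1 + u ^ 2)⁻¹) := by
  rw [← integral_rpow_div hz z.re, ← MeasureTheory.integral_const_mul]
  refine MeasureTheory.norm_integral_le_of_norm_le
    ((integrable_rpow_div hβ hβ1 hz z.re).const_mul C) (Eventually.of_forall fun x => ?_)
  rw [norm_mul, hk, norm_ofReal_sub_sq, mul_one_div, mul_div_assoc']
  gcongr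
  exact hs x z.re

/-! ### Hölder regularity up to the boundary. -/

/-- A function on the upper half-plane whose derivative is `O(y^(β - 1))` is Hölder of order `β`. -/
theorem holder_of_deriv_le {F F' : ℂ → ℂ} {K β : ℝ} (hβ : 0 < β) (hβ1 : β < 1)
    (hF : ∀ z, 0 < z.im → HasDerivAt F (F' z) z)
    (hK : ∀ z, 0 < z.im → ‖F' z‖ ≤ K * z.im ^ (β - 1)) {z w : ℂ} (hz : 0 < z.im)
    (hw : 0 < w.im) : ‖F z - F w‖ ≤ K * (2 / β + 1) * ‖z - w‖ ^ β := by
  have hK0 : 0 ≤ K := by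
    have := (norm_nonneg _).trans (hK Complex.I (by simp))
    simpa using this
  rcases eq_or_ne z w with rfl | hzw
  · simp [Real.zero_rpow hβ.ne']
  set h := ‖z - w‖ with hh
  have hh0 : 0 < h := norm_pos_iff.2 (sub_ne_zero.2 hzw)
  -- The path from `z` to `w` climbs to height `h = ‖z - w‖` above each point and crosses there. On
  -- a vertical leg the bound integrates to `K/β * ((v.im + h)^β - v.im^β)`, at most `K/β * h^β` by
  -- subadditivity. The two legs and the crossing give the constant `2/β + 1`.
  have vert : ∀ v : ℂ, 0 < v.im → ‖F (v + h * Complex.I) - F v‖ ≤ K / β * h ^ β := by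
    intro v hv
    have hpos : ∀ t : ℝ, 0 ≤ t → 0 < (v + t * Complex.I).im := fun t ht => by
      simpa using add_pos_of_pos_of_nonneg hv ht
    have hder : ∀ t : ℝ, 0 ≤ t → HasDerivAt (fun t : ℝ => F (v + t * Complex.I) - F v)
        (F' (v + t * Complex.I) * Complex.I) t := by
      intro t ht
      have h1 : HasDerivAt (fun t : ℝ => v + t * Complex.I) Complex.I t := by
        simpa using ((hasDerivAt_id (t : ℂ)).mul_const Complex.I).comp_ofReal.const_add v
      exact ((hF _ (hpos t ht)).comp t h1).sub_const _
    have hB : ∀ t : ℝ, 0 ≤ t → HasDerivAt (fun t : ℝ => K / β * ((v.im + t) ^ β - v.im ^ β))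
        (K * (v.im + t) ^ (β - 1)) t := by
      intro t ht
      have h1 : HasDerivAt (fun t : ℝ => v.im + t) 1 t := (hasDerivAt_id t).const_add _
      have h2 := (h1.rpow_const (p := β) (Or.inl (by positivity))).sub_const (v.im ^ β)
      convert! h2.const_mul (K / β) using 1
      field_simp
    have := image_norm_le_of_norm_deriv_right_le_deriv_boundary' (a := 0) (b := h)
      (f := fun t : ℝ => F (v + t * Complex.I) - F v)
      (f' := fun t => F' (v + t * Complex.I) * Complex.I)
      (B := fun t : ℝ => K / β * ((v.im + t) ^ β - v.im ^ β))
      (B' := fun t => K * (v.im + t) ^ (β - 1))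
      (fun t ht => (hder t ht.1).continuousAt.continuousWithinAt)
      (fun t ht => (hder t ht.1).hasDerivWithinAt) (by simp)
      (fun t ht => (hB t ht.1).continuousAt.continuousWithinAt)
      (fun t ht => (hB t ht.1).hasDerivWithinAt) (fun t ht => by
        have := hK _ (hpos t ht.1)
        simpa using this) (Set.right_mem_Icc.2 hh0.le)
    refine this.trans ?_
    have h3 := Real.rpow_add_le_add_rpow hv.le hh0.le hβ.le hβ1.le
    have : 0 ≤ K / β := by positivity
    exact mul_le_mul_of_nonneg_left (by linarith) this
  have horiz : ‖F (z + h * Complex.I) - F (w + h * Complex.I)‖ ≤ K * h ^ β := by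
    have hconv : Convex ℝ {v : ℂ | h ≤ v.im} := convex_halfSpace_im_ge h
    have h1 := hconv.norm_image_sub_le_of_norm_hasDerivWithin_le (𝕜 := ℂ) (f := F) (f' := F')
      (C := K * h ^ (β - 1)) (x := w + h * Complex.I) (y := z + h * Complex.I)
      (fun v hv => (hF v (hh0.trans_le hv)).hasDerivWithinAt) (fun v hv => by
        refine (hK v (hh0.trans_le hv)).trans (mul_le_mul_of_nonneg_left ?_ hK0)
        exact Real.rpow_le_rpow_of_nonpos hh0 hv (by linarith))
      (show h ≤ (w + h * Complex.I).im by simpa using hw.le)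
      (show h ≤ (z + h * Complex.I).im by simpa using hz.le)
    rw [add_sub_add_right_eq_sub, ← hh, mul_assoc, ← Real.rpow_add_one hh0.ne',
      sub_add_cancel] at h1
    exact h1
  have e : F z - F w = (F (z + h * Complex.I) - F (w + h * Complex.I)) +
      ((F (w + h * Complex.I) - F w) - (F (z + h * Complex.I) - F z)) := by ring
  rw [e]
  refine (norm_add_le _ _).trans ((add_le_add horiz ((norm_sub_le _ _).trans
    (add_le_add (vert w hw) (vert z hz)))).trans (le_of_eq ?_))
  ring

/-- A Hölder continuous function on the upper half-plane extends to its closure. -/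
theorem exists_extension_of_holder {F : ℂ → ℂ} {K β : ℝ} (hβ : 0 < β)
    (hd : DifferentiableOn ℂ F upperHalf)
    (hF : ∀ z ∈ upperHalf, ∀ w ∈ upperHalf, ‖F z - F w‖ ≤ K * ‖z - w‖ ^ β) :
    ∃ L : ℂ → ℂ, DiffContOnCl ℂ L upperHalf ∧ Set.EqOn L F upperHalf ∧
      ∀ z ∈ closure upperHalf, ∀ w ∈ closure upperHalf, ‖L z - L w‖ ≤ K * ‖z - w‖ ^ β := by
  have hlim : ∀ z ∈ closure upperHalf, ∃ y, Tendsto F (𝓝[upperHalf] z) (𝓝 y) := by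
    intro z hz
    have : (𝓝[upperHalf] z).NeBot := mem_closure_iff_nhdsWithin_neBot.1 hz
    refine cauchy_map_iff_exists_tendsto.1 ?_
    refine cauchy_map_iff.2 ⟨this, ?_⟩
    have h1 : Tendsto (fun p : ℂ × ℂ => K * ‖p.1 - p.2‖ ^ β)
        (𝓝[upperHalf] z ×ˢ 𝓝[upperHalf] z) (𝓝 0) := by
      have hc : Continuous fun p : ℂ × ℂ => K * ‖p.1 - p.2‖ ^ β :=
        continuous_const.mul ((by fun_prop : Continuous fun p : ℂ × ℂ => ‖p.1 - p.2‖).rpow_const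
          fun _ => Or.inr hβ.le)
      have := hc.tendsto (z, z)
      rw [nhds_prod_eq] at this
      simp only [sub_self, norm_zero, Real.zero_rpow hβ.ne', mul_zero] at this
      exact this.mono_left (prod_mono nhdsWithin_le_nhds nhdsWithin_le_nhds)
    rw [tendsto_uniformity_iff_dist_tendsto_zero]
    refine squeeze_zero' (Eventually.of_forall fun _ => dist_nonneg) ?_ h1
    filter_upwards [Eventually.prod_mk (self_mem_nhdsWithin : ∀ᶠ x in 𝓝[upperHalf] z, _)
      (self_mem_nhdsWithin : ∀ᶠ x in 𝓝[upperHalf] z, _)] with p hp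
    rw [dist_eq_norm]
    exact hF _ hp.1 _ hp.2
  have heq : Set.EqOn (extendFrom upperHalf F) F upperHalf := fun z hz =>
    extendFrom_eq (subset_closure hz) (hd.continuousOn z hz)
  have hcont : ContinuousOn (extendFrom upperHalf F) (closure upperHalf) :=
    continuousOn_extendFrom subset_rfl hlim
  have hR : ∀ w : ℂ, Continuous fun z : ℂ => K * ‖z - w‖ ^ β := fun w =>
    continuous_const.mul ((by fun_prop : Continuous fun z : ℂ => ‖z - w‖).rpow_const
      fun _ => Or.inr hβ.le)
  refine ⟨extendFrom upperHalf F, ⟨hd.congr heq, hcont⟩, heq, fun z hz w hw => ?_⟩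
  -- The estimate passes to the closure one variable at a time: first in `z` with `w` in the open
  -- half-plane, then in `w`.
  have step : ∀ w ∈ upperHalf, ∀ z ∈ closure upperHalf,
      ‖extendFrom upperHalf F z - extendFrom upperHalf F w‖ ≤ K * ‖z - w‖ ^ β := by
    intro w hw z hz
    refine le_on_closure (s := upperHalf)
      (f := fun z => ‖extendFrom upperHalf F z - extendFrom upperHalf F w‖) (fun v hv => ?_)
      (hcont.sub continuousOn_const).norm (hR w).continuousOn hz
    simp only [heq hv, heq hw]
    exact hF v hv w hw
  rw [norm_sub_rev, norm_sub_rev z]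
  refine le_on_closure (s := upperHalf)
    (f := fun w => ‖extendFrom upperHalf F w - extendFrom upperHalf F z‖) (fun v hv => ?_)
    (hcont.sub continuousOn_const).norm (hR z).continuousOn hw
  have := step v hv z hz
  rwa [norm_sub_rev, norm_sub_rev z] at this

theorem tendsto_div_of_holder {L : ℂ → ℂ} {K β : ℝ} (hβ1 : β < 1)
    (hL : ∀ z ∈ closure upperHalf, ‖L z‖ ≤ K * ‖z‖ ^ β) :
    Tendsto (fun z => L z / z) (Bornology.cobounded ℂ ⊓ 𝓟 (closure upperHalf)) (𝓝 0) := by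
  have h : Tendsto (fun z : ℂ => K * ‖z‖ ^ (β - 1))
      (Bornology.cobounded ℂ ⊓ 𝓟 (closure upperHalf)) (𝓝 0) := by
    have h1 := (tendsto_rpow_neg_atTop (sub_pos.2 hβ1)).comp (tendsto_norm_cobounded_atTop (E := ℂ))
    have h2 := (h1.const_mul K).mono_left
      (inf_le_left (b := 𝓟 (closure upperHalf)))
    simpa using h2
  refine squeeze_zero_norm' ?_ h
  filter_upwards [mem_inf_of_left (Bornology.eventually_ne_cobounded (0 : ℂ)),
    mem_inf_of_right (mem_principal_self _)] with z h0 hz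
  have hz0 := norm_pos_iff.2 h0
  rw [norm_div, Real.rpow_sub_one hz0.ne', mul_div_assoc']
  exact (div_le_div_iff_of_pos_right hz0).2 (hL z hz)

section CauchyTransform

variable {s : ℝ → ℂ} {C β : ℝ} (hβ : 0 < β) (hβ1 : β < 1)
  (hs : ∀ x y, ‖s x - s y‖ ≤ C * |x - y| ^ β) (h0 : s 0 = 0)

include hβ hβ1 hs h0

/-- The derivative has kernel `1/(x - z)²` of zero integral, so `s x` may be replaced by `s x - s
(Re z)`. The Hölder condition then bounds it by a multiple of `(Im z) ^ (β - 1)`, which gives Hölder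
continuity and hence the extension. -/
theorem exists_cauchyTransform_extension :
    ∃ L : ℂ → ℂ, DiffContOnCl ℂ L upperHalf ∧ Set.EqOn L (cauchyTransform s) upperHalf ∧
      ∃ K : ℝ, ∀ z ∈ closure upperHalf, ∀ w ∈ closure upperHalf,
        ‖L z - L w‖ ≤ K * ‖z - w‖ ^ β := by
  set J := ∫ u : ℝ, |u| ^ β * (1 + u ^ 2)⁻¹
  set c := ‖(2 * Real.pi * Complex.I : ℂ)⁻¹‖
  have hder := fun (z : ℂ) (hz : 0 < z.im) => hasDerivAt_cauchyTransform hβ hβ1 hs h0 hz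
  have hbound : ∀ z : ℂ, 0 < z.im →
      ‖(2 * Real.pi * Complex.I)⁻¹ * ∫ x : ℝ, s x * (1 / ((x : ℂ) - z) ^ 2)‖ ≤
        c * (C * J) * z.im ^ (β - 1) := by
    intro z hz
    have hcont := continuous_of_holder hβ hs
    have hint : ∫ x : ℝ, s x * (1 / ((x : ℂ) - z) ^ 2) =
        ∫ x : ℝ, (s x - s z.re) * (1 / ((x : ℂ) - z) ^ 2) := by
      have hi1 : MeasureTheory.Integrable fun x : ℝ => (s x - s z.re) * (1 / ((x : ℂ) - z) ^ 2) := by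
        have hne : ∀ x : ℝ, ((x : ℂ) - z) ^ 2 ≠ 0 := fun x =>
          pow_ne_zero _ (ofReal_sub_ne_zero hz.ne' x)
        refine ((integrable_rpow_div hβ hβ1 hz z.re).const_mul C).mono'
          (Continuous.aestronglyMeasurable (by fun_prop (disch := assumption)))
          (Eventually.of_forall fun x => ?_)
        rw [norm_mul, norm_div, norm_one, norm_pow, norm_ofReal_sub_sq, mul_one_div, mul_div_assoc']
        gcongr
        exact hs x z.re
      have hi2 := (integrable_one_div_sub_sq hz).const_mul (s z.re)
      have h4 := MeasureTheory.integral_add hi1 hi2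
      rw [MeasureTheory.integral_const_mul, integral_one_div_sub_sq hz, mul_zero, add_zero] at h4
      rw [← h4]
      congr 1
      ext x
      ring
    rw [hint, norm_mul]
    have := norm_integral_holder_div_le hβ hβ1 hs hz (k := fun x : ℝ => 1 / ((x : ℂ) - z) ^ 2)
      (fun x => by simp)
    calc c * _ ≤ c * (C * (z.im ^ (β - 1) * J)) := by gcongr
      _ = _ := by ring
  obtain ⟨L, h1, h2, h3⟩ := exists_extension_of_holder (F := cauchyTransform s) hβ
    (K := c * (C * J) * (2 / β + 1))
    (fun z hz => (hder z hz).differentiableAt.differentiableWithinAt)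
    (fun z hz w hw => holder_of_deriv_le hβ hβ1 hder hbound hz hw)
  exact ⟨L, h1, h2, _, h3⟩

/-- The jump of the Cauchy integral across the real line is the Poisson integral of the density. -/
theorem norm_cauchyTransform_jump_le {x y : ℝ} (hy : 0 < y) :
    ‖cauchyTransform s (x + y * Complex.I) +
      cauchyTransform (fun t => s (-t)) (-x + y * Complex.I) - s x‖ ≤
      (C / Real.pi * ∫ u : ℝ, |u| ^ β * (1 + u ^ 2)⁻¹) * y ^ β := by
  set z : ℂ := x + y * Complex.I with hz
  have hre : z.re = x := by simp [hz]
  have him : z.im = y := by simp [hz]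
  have hz0 : 0 < z.im := him ▸ hy
  have hneg : ∀ a b, ‖s (-a) - s (-b)‖ ≤ C * |a - b| ^ β := fun a b => by
    have := hs (-a) (-b)
    rwa [← neg_sub', abs_neg] at this
  have hpi : (Real.pi : ℂ) ≠ 0 := by exact_mod_cast Real.pi_ne_zero
  have hz1 : 0 < (-(x : ℂ) + y * Complex.I).im := by simpa using hy
  have hi1 := integrable_cauchyTransform hβ hβ1 hs h0 hz0
  have hi2 := (integrable_cauchyTransform hβ hβ1 hneg (by simpa using h0) hz1).comp_neg
  set P : ℝ → ℂ := fun t => (y : ℂ) / (((t - x) ^ 2 + y ^ 2 : ℝ) : ℂ) with hP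
  -- After `t ↦ -t`, the reflected transform carries the kernel of the conjugate point `x - iy` with
  -- the opposite sign. The difference of the two Cauchy kernels is `2i` times the unnormalized
  -- Poisson kernel `P`, and the regularizing terms cancel because they are odd.
  have hk : ∀ t : ℝ, 1 / ((t : ℂ) - z) - t / (1 + (t : ℂ) ^ 2) +
      (1 / (((-t : ℝ) : ℂ) - (-(x : ℂ) + y * Complex.I)) -
        ((-t : ℝ) : ℂ) / (1 + ((-t : ℝ) : ℂ) ^ 2)) = 2 * Complex.I * P t := by
    intro t
    have ha : (t : ℂ) - z ≠ 0 := ofReal_sub_ne_zero hz0.ne' t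
    have hb : ((-t : ℝ) : ℂ) - (-(x : ℂ) + y * Complex.I) ≠ 0 := ofReal_sub_ne_zero hz1.ne' _
    have hfac : (((t - x) ^ 2 + y ^ 2 : ℝ) : ℂ) =
        -(((t : ℂ) - z) * (((-t : ℝ) : ℂ) - (-(x : ℂ) + y * Complex.I))) := by
      rw [hz]
      push_cast
      linear_combination (y : ℂ) ^ 2 * Complex.I_sq
    have hcancel : (t : ℂ) / (1 + (t : ℂ) ^ 2) + ((-t : ℝ) : ℂ) / (1 + ((-t : ℝ) : ℂ) ^ 2) = 0 := by
      push_cast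
      ring
    have e : 1 / ((t : ℂ) - z) + 1 / (((-t : ℝ) : ℂ) - (-(x : ℂ) + y * Complex.I)) =
        2 * Complex.I * P t := by
      simp only [hP]
      rw [hfac]
      field_simp
      rw [hz]
      push_cast
      ring
    linear_combination e - hcancel
  have hsP : MeasureTheory.Integrable fun t => s t * P t := by
    have h := (hi1.add hi2).const_mul (2 * Complex.I)⁻¹
    refine h.congr (Eventually.of_forall fun t => ?_)
    have h1 := hk t
    simp only [Pi.add_apply, neg_neg]
    rw [← mul_add, h1]
    field_simp
  have hPval : ∫ t, P t = Real.pi := by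
    have h := integral_rpow_div (β := 0) hy x
    simp only [Real.rpow_zero, one_mul, zero_sub, integral_univ_inv_one_add_sq,
      Real.rpow_neg_one] at h
    have e : ∀ t, P t = ((y * (1 / ((t - x) ^ 2 + y ^ 2)) : ℝ) : ℂ) := fun t => by
      simp [hP, div_eq_mul_inv]
    simp only [e]
    rw [integral_complex_ofReal, MeasureTheory.integral_const_mul, h, mul_inv_cancel_left₀ hy.ne']
  -- A non-integrable function has Bochner integral 0 by default, so the nonzero value `π` forces
  -- integrability.
  have hPint : MeasureTheory.Integrable P :=
    MeasureTheory.Integrable.of_integral_ne_zero (by rw [hPval]; exact hpi)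
  have hsum : cauchyTransform s z + cauchyTransform (fun t => s (-t)) (-x + y * Complex.I) =
      (Real.pi : ℂ)⁻¹ * ∫ t, s t * P t := by
    rw [cauchyTransform, cauchyTransform, ← mul_add,
      ← MeasureTheory.integral_neg_eq_self (fun t : ℝ => s (-t) *
        (1 / ((t : ℂ) - (-(x : ℂ) + y * Complex.I)) - t / (1 + (t : ℂ) ^ 2))),
      ← MeasureTheory.integral_add hi1 hi2]
    simp only [neg_neg, ← mul_add, hk, mul_left_comm (s _)]
    simp only [mul_assoc, MeasureTheory.integral_const_mul]
    field_simp
  have hdiff : cauchyTransform s z + cauchyTransform (fun t => s (-t)) (-x + y * Complex.I) - s x =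
      ((y : ℂ) / Real.pi) * ∫ t : ℝ, (s t - s z.re) * (1 / (((t - x) ^ 2 + y ^ 2 : ℝ) : ℂ)) := by
    have e : ∀ t : ℝ, (s t - s z.re) * (1 / (((t - x) ^ 2 + y ^ 2 : ℝ) : ℂ)) =
        (y : ℂ)⁻¹ * (s t * P t - s x * P t) := fun t => by
      have := Complex.ofReal_ne_zero.2 hy.ne'
      simp only [hP, hre]
      field_simp
    simp only [e]
    rw [hsum, MeasureTheory.integral_const_mul,
      MeasureTheory.integral_sub hsP (hPint.const_mul _), MeasureTheory.integral_const_mul, hPval]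
    have := Complex.ofReal_ne_zero.2 hy.ne'
    field_simp
  rw [hdiff, norm_mul]
  have hb := norm_integral_holder_div_le hβ hβ1 hs hz0
    (k := fun t : ℝ => 1 / (((t - x) ^ 2 + y ^ 2 : ℝ) : ℂ)) (fun t => by
      rw [norm_ofReal_sub_sq, hre, him, norm_div, norm_one, Complex.norm_real,
        Real.norm_of_nonneg (by positivity)])
  have hn : ‖(y : ℂ) / Real.pi‖ = y / Real.pi := by
    rw [← Complex.ofReal_div, Complex.norm_real, Real.norm_of_nonneg (by positivity)]
  rw [hn]
  refine (mul_le_mul_of_nonneg_left hb (by positivity)).trans (le_of_eq ?_)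
  rw [him, Real.rpow_sub_one hy.ne']
  field_simp

end CauchyTransform

/-! ### Additive decomposition of `s` and construction of a solution. -/

theorem tendsto_add_mul_I (x : ℝ) :
    Tendsto (fun y : ℝ => (x : ℂ) + y * Complex.I) (𝓝[>] 0) (𝓝[closure upperHalf] (x : ℂ)) := by
  refine tendsto_nhdsWithin_iff.2 ⟨?_, ?_⟩
  · have h : Continuous fun y : ℝ => (x : ℂ) + y * Complex.I := by fun_prop
    have := h.tendsto 0
    simp only [Complex.ofReal_zero, zero_mul, add_zero] at this
    exact this.mono_left nhdsWithin_le_nhds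
  · filter_upwards [self_mem_nhdsWithin] with y hy
    exact mem_closure_upperHalf.2 (by simpa using le_of_lt hy)

theorem tendsto_neg_cobounded_closure_lowerHalf :
    Tendsto (Neg.neg : ℂ → ℂ) (Bornology.cobounded ℂ ⊓ 𝓟 (closure lowerHalf))
      (Bornology.cobounded ℂ ⊓ 𝓟 (closure upperHalf)) := by
  refine tendsto_inf.2 ⟨tendsto_inf_left tendsto_neg_cobounded,
    tendsto_inf_right (tendsto_principal_principal.2 fun w hw => ?_)⟩
  rw [mem_closure_upperHalf]
  simpa using mem_closure_lowerHalf.1 hw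

/-- A Hölder continuous density is the sum of the boundary values of a function analytic in the
upper half-plane and the reflection of another one, both sublinear at infinity. -/
theorem exists_boundary_decomposition {s : ℝ → ℂ} {C β : ℝ} (hβ : 0 < β) (hβ1 : β < 1)
    (hs : ∀ x y, ‖s x - s y‖ ≤ C * |x - y| ^ β) (h0 : s 0 = 0) :
    ∃ L M : ℂ → ℂ,
      (DiffContOnCl ℂ L upperHalf ∧ L 0 = 0 ∧
        Tendsto (fun z => L z / z) (Bornology.cobounded ℂ ⊓ 𝓟 (closure upperHalf)) (𝓝 0)) ∧
      (DiffContOnCl ℂ M upperHalf ∧ M 0 = 0 ∧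
        Tendsto (fun z => M z / z) (Bornology.cobounded ℂ ⊓ 𝓟 (closure upperHalf)) (𝓝 0)) ∧
      ∀ x : ℝ, L x + M (-x) = s x := by
  have hneg : ∀ a b, ‖s (-a) - s (-b)‖ ≤ C * |a - b| ^ β := fun a b => by
    have := hs (-a) (-b)
    rwa [← neg_sub', abs_neg] at this
  obtain ⟨L, hL, hLe, K, hK⟩ := exists_cauchyTransform_extension hβ hβ1 hs h0
  obtain ⟨M, hM, hMe, K', hK'⟩ :=
    exists_cauchyTransform_extension hβ hβ1 hneg (by simpa using h0)
  have hzero : (0 : ℂ) ∈ closure upperHalf := by simpa using ofReal_mem_closure_upperHalf 0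
  have hsum : ∀ x : ℝ, L x + M (-x) = s x := by
    intro x
    have h1 := (hL.continuousOn _ (ofReal_mem_closure_upperHalf x)).tendsto.comp
      (tendsto_add_mul_I x)
    have h2 := (hM.continuousOn _ (ofReal_mem_closure_upperHalf (-x))).tendsto.comp
      (tendsto_add_mul_I (-x))
    rw [← Complex.ofReal_neg]
    refine tendsto_nhds_unique (h1.add h2) ?_
    rw [tendsto_iff_norm_sub_tendsto_zero]
    have hR : Tendsto (fun y : ℝ => (C / Real.pi * ∫ u : ℝ, |u| ^ β * (1 + u ^ 2)⁻¹) * y ^ β)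
        (𝓝[>] 0) (𝓝 0) := by
      have hc : Continuous fun y : ℝ =>
          (C / Real.pi * ∫ u : ℝ, |u| ^ β * (1 + u ^ 2)⁻¹) * y ^ β :=
        continuous_const.mul (continuous_id.rpow_const fun _ => Or.inr hβ.le)
      have := hc.tendsto 0
      rw [Real.zero_rpow hβ.ne', mul_zero] at this
      exact this.mono_left nhdsWithin_le_nhds
    refine squeeze_zero' (Eventually.of_forall fun _ => norm_nonneg _) ?_ hR
    filter_upwards [self_mem_nhdsWithin] with y hy
    have hm : ∀ x : ℝ, (x : ℂ) + y * Complex.I ∈ upperHalf := fun x =>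
      show 0 < ((x : ℂ) + y * Complex.I).im by simpa using hy
    have := norm_cauchyTransform_jump_le hβ hβ1 hs h0 (x := x) hy
    rw [Function.comp_apply, Function.comp_apply, hLe (hm x), hMe (hm (-x)), Complex.ofReal_neg]
    exact this
  -- Normalizing at 0 does not disturb the sum, because `L 0 + M 0 = s 0 = 0`.
  refine ⟨fun z => L z - L 0, fun z => M z - M 0, ⟨hL.sub_const _, sub_self _, ?_⟩,
    ⟨hM.sub_const _, sub_self _, ?_⟩, fun x => ?_⟩
  · exact tendsto_div_of_holder hβ1 fun z hz => by simpa using hK z hz 0 hzero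
  · exact tendsto_div_of_holder hβ1 fun z hz => by simpa using hK' z hz 0 hzero
  · have h := hsum 0
    rw [Complex.ofReal_zero, neg_zero, h0] at h
    linear_combination hsum x - h

theorem exists_isRHSolution {g s : ℝ → ℂ} (hs : IsContinuousLog g s) {C α : ℝ≥0} (hα : 0 < α)
    (hα1 : α < 1) (hsC : HolderWith C α s) : ∃ Φp Φm : ℂ → ℂ, IsRHSolution g Φp Φm := by
  obtain ⟨L, M, ⟨hL, hL0, hLi⟩, ⟨hM, hM0, hMi⟩, hsum⟩ := exists_boundary_decomposition
    (s := s) (C := C) (β := α) (by exact_mod_cast hα) (by exact_mod_cast hα1) (fun x y => by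
      have := hsC.dist_le x y
      rwa [dist_eq_norm, Real.dist_eq] at this) hs.2.1
  have hmaps : Set.MapsTo (Neg.neg : ℂ → ℂ) lowerHalf upperHalf := fun w hw => by
    simpa [lowerHalf, upperHalf] using hw
  have hM' : DiffContOnCl ℂ (fun w => M (-w)) lowerHalf :=
    hM.comp (differentiable_neg.diffContOnCl) hmaps
  have hexp : ∀ {f : ℂ → ℂ} {U : Set ℂ}, DiffContOnCl ℂ f U →
      DiffContOnCl ℂ (fun z => Complex.exp (f z)) U := fun hf =>
    Complex.differentiable_exp.comp_diffContOnCl hf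
  refine ⟨fun z => Complex.exp (L z), fun z => Complex.exp (M (-z)),
    ⟨hexp hL, L, hL, fun _ _ => rfl, hL0, hLi⟩,
    ⟨hexp hM', _, hM', fun _ _ => rfl, by simpa using hM0, ?_⟩, fun ω => ?_⟩
  · have := (hMi.comp tendsto_neg_cobounded_closure_lowerHalf).neg
    rw [neg_zero] at this
    refine this.congr fun w => ?_
    simp [div_neg]
  · rw [← Complex.exp_add, hsum, hs.2.2]

theorem mainTheorem2 (g : ℝ → ℂ) (hHolder : SatisfiesHolder g) (hindex : HasZeroIndex g)
    (hg0 : g 0 = 1) :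
    (∃! s : ℝ → ℂ, IsContinuousLog g s) ∧
    ∀ s : ℝ → ℂ, IsContinuousLog g s →
      -- every solution is given by the formula
      (∀ Φp Φm : ℂ → ℂ, IsRHSolution g Φp Φm →
        -- in the open half-planes
        (∀ z : ℂ, z.im ≠ 0 → ∃ d : ℂ, HasSPDiff s z 0 d ∧
          (0 < z.im → Φp z = Complex.exp d) ∧ (z.im < 0 → Φm z = Complex.exp (-d))) ∧
        -- on the real line, where the limits of the integral from above and below
        -- are the principal value plus and minus half of the density
        (∀ ω : ℝ, ∃ d : ℂ, HasSPDiff s ω 0 d ∧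
          Φp ω = Complex.exp (s ω / 2 + d) ∧ Φm ω = Complex.exp (-(-(s ω) / 2 + d))) ∧
        -- with separate integrals, wherever they converge
        (∀ z v v₀ : ℂ, HasSP s z v → HasSP s 0 v₀ →
          (0 < z.im → Φp z = Complex.exp (v - v₀)) ∧
          (z.im < 0 → Φm z = Complex.exp (-v + v₀)))) ∧
      -- and a solution exists as soon as `ln g` satisfies a Hölder condition of order below one
      ((∃ C α : ℝ≥0, 0 < α ∧ α < 1 ∧ HolderWith C α s) →
        ∃ Φp Φm : ℂ → ℂ, IsRHSolution g Φp Φm) := by 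
  have hg := hHolder.continuous
  obtain ⟨s₀, hs₀⟩ := exists_isContinuousLog hg hindex hg0
  refine ⟨⟨s₀, hs₀, fun t ht => ht.unique hs₀⟩, fun s hs => ⟨fun Φp Φm h => h.formula hs, ?_⟩⟩
  rintro ⟨C, α, hα, hα1, hsC⟩
  exact exists_isRHSolution hs hα hα1 hsC
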